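/- Let $n\in\mathbb N$, $n\ge 1$. A variable exponent is a measurable function $p:\mathbb R^n\to(0,\infty]$ with $p^-:=\operatorname{ess\,inf} p>0$. For such $p$, a measurable set $B\subset\mathbb R^n$ and a measurable complex or extended real-valued function $g$, put $\|g\|_{L_{p(\cdot)}(B)}:=\inf\{\lambda>0:\int_B \phi_{p(x)}(|g(x)|/\lambda)\,dx\le 1\}$ (with $\inf\emptyset=\infty$), where $\phi_r(t)=t^r$ for $r<\infty$, and $\phi_\infty(t)=0$ for $t\in[0,1]$, $\phi_\infty(t)=\infty$ for $t>1$. For variable exponents $p,q,u$ with $p(x)\le u(x)$ for all $x$, put $$\|g\|_{M^{u(\cdot)}_{p(\cdot)}}:=\sup_{x\in\mathbb R^n,\,r>0} r^{n\left(\frac1{u(x)}-\frac1{p(x)}\right)}\|g\|_{L_{p(\cdot)}(B_r(x))},\qquad \|(g_j)_j\|_{M^{u(\cdot)}_{p(\cdot)}(\ell_{q(\cdot)})}:=\Big\|\Big(\sum_{j=0}^\infty|g_j(\cdot)|^{q(\cdot)}\Big)^{1/q(\cdot)}\Big\|_{M^{u(\cdot)}_{p(\cdot)}},$$ with $1/\infty=0$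 and with the inner sum replaced by $\sup_j|g_j(x)|$ where $q(x)=\infty$. For reals $\alpha_1\le\alpha_2$ and $\alpha\ge0$ let $\mathcal W^{\alpha}_{\alpha_1,\alpha_2}$ be the class of sequences $(w_j)_{j\in\mathbb N_0}$ of measurable functions $w_j:\mathbb R^n\to(0,\infty)$ such that, for some constant $C>0$ and all $x,y\in\mathbb R^n$, $j\in\mathbb N_0$, $w_j(x)\le C\,w_j(y)(1+2^j|x-y|)^\alpha$ and $2^{\alpha_1}w_j(x)\le w_{j+1}(x)\le 2^{\alpha_2}w_j(x)$. For Schwartz functions $\psi_0,\psi_1\in\mathcal S(\mathbb R^n)$ (complex-valued) let $\psi_j(x):=\psi_1(2^{-j+1}x)$ for $j\ge2$ and $\Psi_j:=\hat\psi_j$ for all $j\in\mathbb N_0$, where $\hat\psi(x)=(2\pi)^{-n/2}\int_{\mathbb R^n}e^{-ix\cdot\xi}\psi(\xi)\,d\xi$; define $\phi_j$, $\Phi_j=\hat\phi_j$ from $\phi_0,\phi_1\in\mathcal S(\mathbb R^n)$ in the same way. For $a>0$ and a tempered distribution $f\in\mathcal S'(\mathbb R^n)$ the Peetre maximal function is $$(\Psi_j^*f)_a(x):=\sup_{y\in\mathbb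 R^n}\frac{|(\Psi_j*f)(y)|}{1+|2^j(y-x)|^a}\in[0,\infty],\qquad x\in\mathbb R^n .$$ **Theorem.** Let $(w_j)_j\in\mathcal W^{\alpha}_{\alpha_1,\alpha_2}$, let $p,q,u$ be variable exponents with $p\le u$, let $a>0$ and let $R\in\mathbb N_0$ with $R>\alpha_2$. Let $\psi_0,\psi_1\in\mathcal S(\mathbb R^n)$ with $D^\beta\psi_1(0)=0$ for all multi-indices $\beta$ with $0\le|\beta|<R$, and let $\phi_0,\phi_1\in\mathcal S(\mathbb R^n)$ be such that, for some $\varepsilon>0$ and $k\in(1,2]$, $|\phi_0(x)|>0$ whenever $|x|\le k\varepsilon$, and $|\phi_1(x)|>0$ whenever $\varepsilon\le|x|\le 2k\varepsilon$. Then there is a constant $c>0$ such that $$\|((\Psi_j^*f)_a\,w_j)_j\|_{M^{u(\cdot)}_{p(\cdot)}(\ell_{q(\cdot)})}\le c\,\|((\Phi_j^*f)_a\,w_j)_j\|_{M^{u(\cdot)}_{p(\cdot)}(\ell_{q(\cdot)})}\qquad\text{for every } f\in\mathcal S'(\mathbb R^n).$$ (Both sides are elements of $[0,\infty]$.) -/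

import Mathlib

open MeasureTheory
open scoped ENNReal SchwartzMap FourierTransform LineDeriv

namespace VarMorrey

noncomputable section

/-- Euclidean space `ℝⁿ`. -/
abbrev Rn (n : ℕ) := EuclideanSpace ℝ (Fin n)

/-! ### Variable exponents, Lebesgue and Morrey quasi-norms

The quasi-norms only see `|f|`, so they are defined for functions with values in `[0, ∞]`. -/

/-- Variable exponents: measurable `p : ℝⁿ → (0, ∞]` with `ess inf p > 0`. -/
structure IsVarExponent {n : ℕ} (p : Rn n → ℝ≥0∞) : Prop where
  measurable : Measurable p
  pos : ∀ x, 0 < p x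
  essInf_pos : 0 < essInf p volume

/-- `φ_p(t) = t ^ p` for `p < ∞`; for `p = ∞` it is `0` on `[0, 1]` and `∞` on `(1, ∞]`. -/
def phi (p t : ℝ≥0∞) : ℝ≥0∞ :=
  if p = ∞ then (if t ≤ 1 then 0 else ∞) else t ^ p.toReal

/-- The semimodular of `L_{p(·)}(B)`. -/
def modular {n : ℕ} (p : Rn n → ℝ≥0∞) (B : Set (Rn n)) (f : Rn n → ℝ≥0∞) : ℝ≥0∞ :=
  ∫⁻ x in B, phi (p x) (f x)

/-- The Luxemburg quasi-norm of `L_{p(·)}(B)`, with value `∞` outside of the space. -/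
def lebesgueNorm {n : ℕ} (p : Rn n → ℝ≥0∞) (B : Set (Rn n)) (f : Rn n → ℝ≥0∞) : ℝ≥0∞ :=
  sInf {l : ℝ≥0∞ | 0 < l ∧ l < ∞ ∧ modular p B (fun x => f x / l) ≤ 1}

/-- The Morrey quasi-norm of `M_{p(·)}^{u(·)}(ℝⁿ)`:
`sup_{x, r > 0} r ^ (n (1 / u(x) - 1 / p(x))) ‖f‖_{L_{p(·)}(B_r(x))}`. -/
def morreyNorm {n : ℕ} (p u : Rn n → ℝ≥0∞) (f : Rn n → ℝ≥0∞) : ℝ≥0∞ :=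
  ⨆ (x : Rn n) (r : ℝ) (_ : 0 < r),
    ENNReal.ofReal (r ^ ((n : ℝ) * (((u x)⁻¹).toReal - ((p x)⁻¹).toReal))) *
      lebesgueNorm p (Metric.ball x r) f

/-- The `ℓ_q` quasi-norm of a sequence, `0 < q ≤ ∞`. -/
def ellNorm (q : ℝ≥0∞) (g : ℕ → ℝ≥0∞) : ℝ≥0∞ :=
  if q = ∞ then ⨆ j, g j else (∑' j, g j ^ q.toReal) ^ (1 / q.toReal)

/-- The quasi-norm of `M_{p(·)}^{u(·)}(ℓ_{q(·)})`. -/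
def morreyEllNorm {n : ℕ} (p u q : Rn n → ℝ≥0∞) (g : ℕ → Rn n → ℝ≥0∞) : ℝ≥0∞ :=
  morreyNorm p u (fun x => ellNorm (q x) (fun j => g j x))

/-! ### Admissible weights -/

/-- The class `W^α_{α₁,α₂}` of admissible weight sequences. -/
structure IsAdmissibleWeight {n : ℕ} (α α₁ α₂ : ℝ) (w : ℕ → Rn n → ℝ) : Prop where
  le_exponents : α₁ ≤ α₂
  nonneg : 0 ≤ α
  measurable : ∀ j, Measurable (w j)
  pos : ∀ j x, 0 < w j x
  growth : ∃ C : ℝ, 0 < C ∧ ∀ j x y, w j x ≤ C * w j y * (1 + 2 ^ j * ‖x - y‖) ^ α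
  lower : ∀ j x, (2 : ℝ) ^ α₁ * w j x ≤ w (j + 1) x
  upper : ∀ j x, w (j + 1) x ≤ (2 : ℝ) ^ α₂ * w j x

/-! ### Dilations, Fourier transform, convolution, Peetre maximal function -/

/-- The dilation `x ↦ ψ (t x)`, `t ≠ 0`. -/
def dilate {n : ℕ} (t : ℝ) (ht : t ≠ 0) (ψ : 𝓢(Rn n, ℂ)) : 𝓢(Rn n, ℂ) :=
  SchwartzMap.compCLMOfContinuousLinearEquiv ℂ
    (ContinuousLinearEquiv.smulLeft (R₁ := ℝ) (M₁ := Rn n) (Units.mk0 t ht)) ψ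

theorem dilate_apply {n : ℕ} (t : ℝ) (ht : t ≠ 0) (ψ : 𝓢(Rn n, ℂ)) (x : Rn n) :
    dilate t ht ψ x = ψ (t • x) := rfl

/-- The system generated by `ψ₀, ψ₁`: `ψ_j (x) = ψ₁ (2 ^ (-j + 1) x)` for `j ≥ 1`. -/
def dyadicSystem {n : ℕ} (ψ₀ ψ₁ : 𝓢(Rn n, ℂ)) : ℕ → 𝓢(Rn n, ℂ)
  | 0 => ψ₀
  | j + 1 => dilate (((2 : ℝ) ^ j)⁻¹) (by positivity) ψ₁

/-- The Fourier transform
`ψ̂(x) = (2π) ^ (-n/2) ∫ e ^ (-i x·ξ) ψ(ξ) dξ` on the Schwartz space,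
see `fourierHat_apply`; Mathlib's `𝓕` has the kernel `e ^ (-2πi x·ξ)` and no prefactor. -/
def fourierHat {n : ℕ} (ψ : 𝓢(Rn n, ℂ)) : 𝓢(Rn n, ℂ) :=
  (((2 * Real.pi) ^ (-(n : ℝ) / 2) : ℝ) : ℂ) •
    dilate ((2 * Real.pi)⁻¹) (by positivity) (𝓕 ψ)

theorem fourierHat_apply {n : ℕ} (ψ : 𝓢(Rn n, ℂ)) (x : Rn n) :
    fourierHat ψ x = (((2 * Real.pi) ^ (-(n : ℝ) / 2) : ℝ) : ℂ) *
      ∫ ξ : Rn n, Complex.exp (-Complex.I * (inner ℝ x ξ : ℝ)) * ψ ξ := by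
  have h : fourierHat ψ x = (((2 * Real.pi) ^ (-(n : ℝ) / 2) : ℝ) : ℂ) *
      𝓕 (ψ : Rn n → ℂ) ((2 * Real.pi)⁻¹ • x) := rfl
  rw [h, Real.fourier_eq']
  congr 1
  refine integral_congr_ae (Filter.Eventually.of_forall fun ξ => ?_)
  simp only [smul_eq_mul]
  congr 2
  have hpi : (-2 * Real.pi * inner ℝ ξ ((2 * Real.pi)⁻¹ • x) : ℝ) = -inner ℝ x ξ := by
    rw [inner_smul_right, real_inner_comm]
    have := Real.pi_ne_zero
    field_simp
  rw [hpi]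
  push_cast
  ring

/-- The convolution `(Ψ * f)(y) = f (Ψ (y - ·))` of a Schwartz function with a tempered
distribution. -/
def conv {n : ℕ} (Ψ : 𝓢(Rn n, ℂ)) (f : 𝓢'(Rn n, ℂ)) (y : Rn n) : ℂ :=
  f (SchwartzMap.compSubConstCLM ℂ y (dilate (-1) (by norm_num) Ψ))

/-- The test function in the definition of `conv` is `x ↦ Ψ (y - x)`. -/
theorem conv_test_apply {n : ℕ} (Ψ : 𝓢(Rn n, ℂ)) (y x : Rn n) :
    SchwartzMap.compSubConstCLM ℂ y (dilate (-1) (by norm_num) Ψ) x = Ψ (y - x) := by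
  simp [dilate_apply]

/-- The Peetre maximal function
`(Ψ_j^* f)_a (x) = sup_y |(Ψ_j * f)(y)| / (1 + |2 ^ j (y - x)| ^ a)`, where `Ψ_j` is the Fourier
transform of `ψ_j`. It may take the value `∞`. -/
def peetre {n : ℕ} (ψ : ℕ → 𝓢(Rn n, ℂ)) (a : ℝ) (f : 𝓢'(Rn n, ℂ)) (j : ℕ) (x : Rn n) : ℝ≥0∞ :=
  ⨆ y : Rn n, ENNReal.ofReal
    (‖conv (fourierHat (ψ j)) f y‖ / (1 + ‖(2 : ℝ) ^ j • (y - x)‖ ^ a))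

/-- The sequence `((Ψ_j^* f)_a w_j)_j`. -/
def weightedPeetre {n : ℕ} (ψ : ℕ → 𝓢(Rn n, ℂ)) (a : ℝ) (w : ℕ → Rn n → ℝ) (f : 𝓢'(Rn n, ℂ))
    (j : ℕ) (x : Rn n) : ℝ≥0∞ :=
  peetre ψ a f j x * ENNReal.ofReal (w j x)

/-- `D^β ψ (0) = 0` for all multi-indices with `|β| < R`: every iterated partial derivative of
`ψ` of order `m < R`, in coordinate directions `i 0, …, i (m - 1)`, vanishes at the origin. -/
def MomentCondition {n : ℕ} (R : ℕ) (ψ : 𝓢(Rn n, ℂ)) : Prop :=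
  ∀ m < R, ∀ i : Fin m → Fin n,
    (∂^{fun l => (EuclideanSpace.single (i l) (1 : ℝ) : Rn n)} ψ) 0 = 0

/-- The Tauberian conditions with parameters `ε` and `k`. -/
def TauberianCondition {n : ℕ} (ε k : ℝ) (φ₀ φ₁ : 𝓢(Rn n, ℂ)) : Prop :=
  (∀ x, ‖x‖ ≤ k * ε → 0 < ‖φ₀ x‖) ∧ (∀ x, ε ≤ ‖x‖ → ‖x‖ ≤ 2 * k * ε → 0 < ‖φ₁ x‖)

end

end VarMorrey

namespace VarMorrey

/-! ### Monotonicity and homogeneity of the quasi-norms -/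

/-! The Tauberian condition provides Schwartz functions η_j, dilates of η₀ or η₁ in the same way as
the φ_j, with Σ_j η_j φ_j = 1. Hence ψ_ν = Σ_j (ψ_ν η_j) φ_j in the Schwartz space
(`exists_resolution`, `tendsto_of_cutoff`), and Ψ_ν * f is a series of averages of translates of Φ_j
* f against the Fourier transform of ψ_ν η_j (`convCLM_dilate_schwartzMul`). Each average is at most
(Φ_j^* f)_a(x) times a weighted L₁ norm of that transform.

Rescaled to unit frequency, this norm is O(2^{-R(ν-j)}) for j ≤ ν, because ψ₁ vanishes to order R at
0, and O(2^{-N(j-ν)}) for j > ν with N arbitrary, because η₁ vanishes near 0 and ψ₀, ψ₁ decay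
rapidly (`exists_fourierWeight_linkSymbol_le`). Comparing Peetre denominators costs 2^{a(j-ν)} for j
> ν, and w_ν/w_j costs 2^{α₂(ν-j)} or 2^{-α₁(j-ν)}. Since R > α₂ and N is large, a factor δ^{|ν-j|}
with δ = 2^{α₂-R} < 1 remains (`exists_weightedPeetre_le_tsum`).

Both sides of this bound are evaluated at the same point x, so q(x) is frozen and a scalar
convolution inequality applies, uniformly for q(x) ≥ ess inf q > 0. Monotonicity and homogeneity of
the Morrey quasi-norm finish the proof (`exists_morreyEllNorm_le`); no maximal operator enters. -/

theorem phi_mono (p : ℝ≥0∞) {s t : ℝ≥0∞} (h : s ≤ t) : phi p s ≤ phi p t := by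
  unfold phi
  split_ifs with _ h₁ h₂ h₂
  · exact le_rfl
  · exact zero_le
  · exact absurd (h.trans h₂) h₁
  · exact le_rfl
  · exact ENNReal.rpow_le_rpow h ENNReal.toReal_nonneg

theorem lebesgueNorm_le_mul {n : ℕ} (p : Rn n → ℝ≥0∞) (B : Set (Rn n)) {f g : Rn n → ℝ≥0∞}
    {c : ℝ≥0∞} (hc : c ≠ 0) (hc' : c ≠ ∞) (h : ∀ᵐ x, f x ≤ c * g x) :
    lebesgueNorm p B f ≤ c * lebesgueNorm p B g := by
  unfold lebesgueNorm
  rw [mul_comm, ← ENNReal.div_le_iff_le_mul (Or.inl hc) (Or.inl hc')]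
  refine le_sInf fun l ⟨hl, hl', hm⟩ => ?_
  rw [ENNReal.div_le_iff_le_mul (Or.inl hc) (Or.inl hc')]
  refine sInf_le ⟨(ENNReal.mul_pos hl.ne' hc), ENNReal.mul_lt_top hl' hc'.lt_top, le_trans ?_ hm⟩
  refine lintegral_mono_ae (ae_restrict_of_ae (h.mono fun x hx => phi_mono _ ?_))
  rw [mul_comm l c]
  calc f x / (c * l) ≤ c * g x / (c * l) := by gcongr
    _ = g x / l := ENNReal.mul_div_mul_left _ _ hc hc'

theorem morreyNorm_le_mul {n : ℕ} (p u : Rn n → ℝ≥0∞) {f g : Rn n → ℝ≥0∞} {c : ℝ≥0∞}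
    (hc : c ≠ 0) (hc' : c ≠ ∞) (h : ∀ᵐ x, f x ≤ c * g x) :
    morreyNorm p u f ≤ c * morreyNorm p u g := by
  unfold morreyNorm
  refine iSup_le fun x => iSup_le fun r => iSup_le fun hr => ?_
  grw [lebesgueNorm_le_mul p _ hc hc' h, mul_left_comm]
  gcongr
  exact le_iSup_of_le x (le_iSup_of_le r (le_iSup_of_le hr le_rfl))

/-! ### A discrete convolution inequality -/

theorem tsum_pow_natDist_le {s : ℝ≥0∞} (ν : ℕ) :
    ∑' j, s ^ Nat.dist ν j ≤ 2 * ∑' m, s ^ m := by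
  have hsub : ∀ j, s ^ Nat.dist ν j ≤
      (if j ≤ ν then s ^ (ν - j) else 0) + (if ν ≤ j then s ^ (j - ν) else 0) := by
    intro j
    rcases le_total j ν with h | h
    · rw [if_pos h, Nat.dist_eq_sub_of_le_right h]; exact le_self_add
    · rw [if_pos h, Nat.dist_eq_sub_of_le h]; exact le_add_self
  refine (ENNReal.tsum_le_tsum hsub).trans ?_
  rw [ENNReal.tsum_add, two_mul]
  refine add_le_add ?_ ?_
  · rw [tsum_eq_sum (s := Finset.range (ν + 1))
      fun j hj => if_neg (by simpa [Nat.lt_succ_iff] using hj)]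
    rw [← Finset.sum_range_reflect]
    refine le_trans (le_of_eq (Finset.sum_congr rfl fun j hj => ?_))
      (ENNReal.sum_le_tsum (Finset.range (ν + 1)))
    rw [Finset.mem_range] at hj
    rw [if_pos (by omega)]
    congr 1
    omega
  · refine le_of_eq ?_
    rw [← (add_left_injective ν).tsum_eq (f := fun j => if ν ≤ j then s ^ (j - ν) else 0)]
    · simp
    · intro j hj
      simp only [Function.mem_support, ne_eq, ite_eq_right_iff, Classical.not_imp] at hj
      exact ⟨j - ν, by simp only; omega⟩

/-- Assuming a supremum bound rather than a sum treats q < 1 and q ≥ 1 alike: the q-th power of a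
supremum is at most the sum of the q-th powers, and the two sums can then be interchanged. The
constant depends on q₀ only, since s ≤ 1 gives s^q ≤ s^q₀ and S ≥ 1 gives S^(1/q) ≤ S^(1/q₀). -/
theorem ellNorm_le_of_forall_le {s S : ℝ≥0∞} {q₀ : ℝ} (hq₀ : 0 < q₀) (hs : s ≤ 1)
    (hS : 2 * ∑' m, (s ^ q₀) ^ m ≤ S) (hS₁ : 1 ≤ S) {q : ℝ≥0∞} (hq : ENNReal.ofReal q₀ ≤ q)
    {A : ℝ≥0∞} {g G : ℕ → ℝ≥0∞}
    (h : ∀ ν, G ν ≤ A * ⨆ j, s ^ Nat.dist ν j * g j) :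
    ellNorm q G ≤ A * S ^ (1 / q₀) * ellNorm q g := by
  unfold ellNorm
  split_ifs with hqt
  · have hK : 1 ≤ S ^ (1 / q₀) := ENNReal.one_le_rpow hS₁ (by positivity)
    refine iSup_le fun ν => (h ν).trans ?_
    rw [mul_assoc]
    gcongr
    refine iSup_le fun j => ?_
    calc s ^ Nat.dist ν j * g j ≤ 1 * g j := by gcongr; exact pow_le_one' hs _
      _ ≤ S ^ (1 / q₀) * ⨆ j, g j := by gcongr; exact le_iSup g j
  · have hq1 : q₀ ≤ q.toReal := by
      rwa [← ENNReal.ofReal_le_iff_le_toReal hqt]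
    set t := q.toReal
    have ht : 0 < t := hq₀.trans_le hq1
    have key : ∀ ν, G ν ^ t ≤ A ^ t * ∑' j, (s ^ q₀) ^ Nat.dist ν j * g j ^ t := by
      intro ν
      refine (ENNReal.rpow_le_rpow (h ν) ht.le).trans ?_
      rw [ENNReal.mul_rpow_of_nonneg _ _ ht.le]
      gcongr
      -- Writing the right side as a t-th power moves the exponent inside the supremum, where each
      -- term is one summand of the series.
      rw [← (ENNReal.orderIsoRpow t ht).apply_symm_apply
        (∑' j, (s ^ q₀) ^ Nat.dist ν j * g j ^ t), ENNReal.orderIsoRpow_apply]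
      refine ENNReal.rpow_le_rpow (iSup_le fun j => ?_) ht.le
      rw [OrderIso.le_symm_apply, ENNReal.orderIsoRpow_apply]
      refine le_trans ?_ (ENNReal.le_tsum j)
      rw [ENNReal.mul_rpow_of_nonneg _ _ ht.le]
      gcongr
      rw [← ENNReal.rpow_natCast, ← ENNReal.rpow_natCast, ← ENNReal.rpow_mul, ← ENNReal.rpow_mul,
        mul_comm, mul_comm q₀]
      refine ENNReal.rpow_le_rpow_of_exponent_ge hs ?_
      rw [mul_comm]
      gcongr
    calc (∑' ν, G ν ^ t) ^ (1 / t)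
        ≤ (∑' ν, A ^ t * ∑' j, (s ^ q₀) ^ Nat.dist ν j * g j ^ t) ^ (1 / t) := by
          gcongr with ν; exact key ν
      _ = (A ^ t * ∑' j, (∑' ν, (s ^ q₀) ^ Nat.dist j ν) * g j ^ t) ^ (1 / t) := by
          rw [ENNReal.tsum_mul_left, ENNReal.tsum_comm]
          simp_rw [ENNReal.tsum_mul_right, Nat.dist_comm]
      _ ≤ (A ^ t * ∑' j, S * g j ^ t) ^ (1 / t) := by
          gcongr with j
          exact (tsum_pow_natDist_le j).trans hS
      _ = A * S ^ (1 / t) * (∑' j, g j ^ t) ^ (1 / t) := by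
          rw [ENNReal.tsum_mul_left, ENNReal.mul_rpow_of_nonneg _ _ (by positivity),
            ENNReal.mul_rpow_of_nonneg _ _ (by positivity), ← ENNReal.rpow_mul,
            mul_one_div_cancel ht.ne', ENNReal.rpow_one, mul_assoc]
      _ ≤ A * S ^ (1 / q₀) * (∑' j, g j ^ t) ^ (1 / t) := by
          gcongr A * ?_ * _
          exact ENNReal.rpow_le_rpow_of_exponent_le hS₁ (one_div_le_one_div_of_le hq₀ hq1)

/-- The decay rate is split in two: one factor s makes the series converge, the other stays inside
the supremum. -/
theorem tsum_pow_natDist_mul_le_iSup (s : ℝ≥0∞) (g : ℕ → ℝ≥0∞) (ν : ℕ) :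
    ∑' j, (s * s) ^ Nat.dist ν j * g j ≤
      (2 * ∑' m, s ^ m) * ⨆ j, s ^ Nat.dist ν j * g j := by
  calc ∑' j, (s * s) ^ Nat.dist ν j * g j
      ≤ ∑' j, s ^ Nat.dist ν j * ⨆ j, s ^ Nat.dist ν j * g j := by
        refine ENNReal.tsum_le_tsum fun j => ?_
        rw [mul_pow, mul_assoc]
        gcongr
        exact le_iSup (fun j => s ^ Nat.dist ν j * g j) j
    _ ≤ _ := by
        rw [ENNReal.tsum_mul_right]
        gcongr
        exact tsum_pow_natDist_le ν

theorem tsum_geometric_ne_top {s : ℝ≥0∞} (hs : s < 1) : ∑' m : ℕ, s ^ m ≠ ∞ := by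
  rw [ENNReal.tsum_geometric]
  exact ENNReal.inv_ne_top.2 (tsub_pos_of_lt hs).ne'

/-- A sequence dominated pointwise by a geometrically decaying discrete convolution is dominated
in the Morrey quasi-norm. -/
theorem exists_morreyEllNorm_le {n : ℕ} (p u : Rn n → ℝ≥0∞) {q : Rn n → ℝ≥0∞}
    (hq : IsVarExponent q) {s : ℝ≥0∞} (hs : s < 1) {A : ℝ≥0∞} (hA₀ : A ≠ 0)
    (hA : A ≠ ∞) :
    ∃ c : ℝ, 0 < c ∧ ∀ g G : ℕ → Rn n → ℝ≥0∞,
      (∀ ν x, G ν x ≤ A * ∑' j, (s * s) ^ Nat.dist ν j * g j x) →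
      morreyEllNorm p u q G ≤ ENNReal.ofReal c * morreyEllNorm p u q g := by
  -- The essential infimum may be ∞; the minimum with 1 gives a finite positive lower bound for q.
  set q₁ : ℝ≥0∞ := min 1 (essInf q volume)
  have hq₁ : 0 < q₁ := lt_min one_pos hq.essInf_pos
  have hq₁' : q₁ ≠ ∞ := ((min_le_left _ _).trans_lt ENNReal.one_lt_top).ne
  set q₀ : ℝ := q₁.toReal
  have hq₀ : 0 < q₀ := ENNReal.toReal_pos hq₁.ne' hq₁'
  set S : ℝ≥0∞ := 1 + 2 * ∑' m : ℕ, (s ^ q₀) ^ m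
  have hS : S ≠ ∞ := by
    refine ENNReal.add_ne_top.2 ⟨ENNReal.one_ne_top, ENNReal.mul_ne_top (by simp) ?_⟩
    exact tsum_geometric_ne_top (ENNReal.rpow_lt_one hs hq₀)
  set T : ℝ≥0∞ := 2 * ∑' m : ℕ, s ^ m
  have hT : T ≠ ∞ := ENNReal.mul_ne_top (by simp) (tsum_geometric_ne_top hs)
  have hT₀ : T ≠ 0 := by
    refine mul_ne_zero (by simp) fun h => ?_
    simpa using ENNReal.tsum_eq_zero.1 h 0
  set c : ℝ≥0∞ := A * T * S ^ (1 / q₀)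
  have hS₁ : 1 ≤ S := le_self_add
  have hc : c ≠ ∞ := ENNReal.mul_ne_top (ENNReal.mul_ne_top hA hT)
    (ENNReal.rpow_ne_top_of_nonneg (by positivity) hS)
  have hc₀ : c ≠ 0 := mul_ne_zero (mul_ne_zero hA₀ hT₀)
    (one_pos.trans_le (ENNReal.one_le_rpow hS₁ (by positivity))).ne'
  refine ⟨c.toReal, ENNReal.toReal_pos hc₀ hc, fun g G h => ?_⟩
  rw [ENNReal.ofReal_toReal hc]
  refine morreyNorm_le_mul p u hc₀ hc ?_
  filter_upwards [ae_essInf_le (f := q) (μ := volume)] with x hx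
  refine ellNorm_le_of_forall_le hq₀ hs.le le_add_self hS₁ ?_ fun ν => ?_
  · rw [ENNReal.ofReal_toReal hq₁']
    exact (min_le_right _ _).trans hx
  · refine (h ν x).trans ?_
    rw [mul_assoc]
    gcongr
    exact tsum_pow_natDist_mul_le_iSup s (fun j => g j x) ν

open scoped ContDiff BoundedContinuousFunction

/-! ### Parameter-uniform Schwartz seminorm estimates. -/

section Schwartz

variable {E : Type*} [NormedAddCommGroup E] [NormedSpace ℝ E]

/-- The pointwise product of two Schwartz functions. -/
noncomputable def schwartzMul (f g : 𝓢(E, ℂ)) : 𝓢(E, ℂ) :=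
  SchwartzMap.pairing (ContinuousLinearMap.mul ℂ ℂ) f g

@[simp]
theorem schwartzMul_apply (f g : 𝓢(E, ℂ)) (x : E) : schwartzMul f g x = f x * g x :=
  SchwartzMap.pairing_apply_apply _ f g x

theorem exists_one_add_norm_pow_mul_le {F : Type*} [NormedAddCommGroup F] [NormedSpace ℝ F]
    (f : 𝓢(E, F)) (k l : ℕ) :
    ∃ C : ℝ, 0 ≤ C ∧ ∀ x, (1 + ‖x‖) ^ k * ‖iteratedFDeriv ℝ l f x‖ ≤ C :=
  ⟨_, by positivity, fun x =>
    SchwartzMap.one_add_le_sup_seminorm_apply (𝕜 := ℝ) (m := (k, l)) le_rfl le_rfl f x⟩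

/-- Leibniz rule: polynomial growth of the derivatives of `h t` is absorbed by the decay of η, and
matters only on the support of η. The factor `θ t` records the dependence on the parameter. -/
theorem exists_seminorm_mul_le {ι : Type*} {h : ι → E → ℂ} {η : 𝓢(E, ℂ)} {g : ι → 𝓢(E, ℂ)}
    {θ : ι → ℝ} (hg : ∀ t x, g t x = h t x * η x) (hh : ∀ t, ContDiff ℝ ∞ (h t))
    (hθ : ∀ t, 0 ≤ θ t)
    (hb : ∀ i : ℕ, ∃ (A : ℝ) (B : ℕ), 0 ≤ A ∧ ∀ t, ∀ x ∈ tsupport η,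
      ‖iteratedFDeriv ℝ i (h t) x‖ ≤ A * θ t * (1 + ‖x‖) ^ B) (k l : ℕ) :
    ∃ C : ℝ, 0 ≤ C ∧ ∀ t, SchwartzMap.seminorm ℂ k l (g t) ≤ C * θ t := by
  choose A B hA hAB using hb
  choose K hK hKη using fun i => exists_one_add_norm_pow_mul_le η (B i + k) (l - i)
  have hC : 0 ≤ ∑ i ∈ Finset.range (l + 1), (l.choose i : ℝ) * A i * K i :=
    Finset.sum_nonneg fun i _ => mul_nonneg (mul_nonneg (by positivity) (hA i)) (hK i)
  refine ⟨_, hC, fun t => SchwartzMap.seminorm_le_bound ℂ k l _ (mul_nonneg hC (hθ t)) fun x => ?_⟩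
  have hgt : (g t : E → ℂ) = fun x => h t x * η x := funext (hg t)
  rw [hgt]
  grw [norm_iteratedFDeriv_mul_le (hh t) (η.smooth ⊤) x (n := l) (by exact_mod_cast le_top)]
  rw [Finset.mul_sum, Finset.sum_mul]
  refine Finset.sum_le_sum fun i _ => ?_
  by_cases hx : x ∈ tsupport η
  · have hxk : ‖x‖ ^ k ≤ (1 + ‖x‖) ^ k := by gcongr; linarith
    calc ‖x‖ ^ k * (l.choose i * ‖iteratedFDeriv ℝ i (h t) x‖ * ‖iteratedFDeriv ℝ (l - i) η x‖)
        ≤ (1 + ‖x‖) ^ k *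
          (l.choose i * (A i * θ t * (1 + ‖x‖) ^ B i) * ‖iteratedFDeriv ℝ (l - i) η x‖) := by
          gcongr
          exact hAB i t x hx
      _ = l.choose i * A i * ((1 + ‖x‖) ^ (B i + k) * ‖iteratedFDeriv ℝ (l - i) η x‖) * θ t := by
          rw [pow_add]; ring
      _ ≤ l.choose i * A i * K i * θ t := by
          have := hA i
          have := hθ t
          gcongr
          exact hKη i x
  · have h0 : iteratedFDeriv ℝ (l - i) η x = 0 := by
      by_contra h0
      exact hx (support_iteratedFDeriv_subset (l - i) h0)
    rw [h0, norm_zero, mul_zero, mul_zero]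
    exact mul_nonneg (mul_nonneg (mul_nonneg (by positivity) (hA i)) (hK i)) (hθ t)

theorem exists_continuous_seminorm_le {ι : Type*} {g : ι → 𝓢(E, ℂ)} {θ : ι → ℝ}
    (hθ : ∀ t, 0 ≤ θ t)
    (hg : ∀ k l : ℕ, ∃ C : ℝ, 0 ≤ C ∧ ∀ t, SchwartzMap.seminorm ℂ k l (g t) ≤ C * θ t)
    {q : Seminorm ℂ 𝓢(E, ℂ)} (hq : Continuous q) :
    ∃ C : ℝ, 0 ≤ C ∧ ∀ t, q (g t) ≤ C * θ t := by
  choose K hK hKg using hg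
  obtain ⟨s, C, -, hC⟩ := Seminorm.bound_of_continuous (schwartz_withSeminorms ℂ E ℂ) q hq
  refine ⟨C * ∑ m ∈ s, K m.1 m.2, mul_nonneg C.2 (Finset.sum_nonneg fun m _ => hK _ _),
    fun t => (hC (g t)).trans ?_⟩
  rw [mul_assoc]
  change (C : ℝ) * (s.sup (schwartzSeminormFamily ℂ E ℂ)) (g t) ≤ _
  gcongr
  refine Seminorm.finset_sup_apply_le
    (mul_nonneg (Finset.sum_nonneg fun m _ => hK _ _) (hθ t)) fun m hm => ?_
  refine (hKg m.1 m.2 t).trans ?_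
  have := hθ t
  gcongr
  exact Finset.single_le_sum (f := fun m : ℕ × ℕ => K m.1 m.2) (fun m _ => hK _ _) hm

theorem norm_iteratedFDeriv_sub_le {F : Type*} [NormedAddCommGroup F] [NormedSpace ℝ F]
    (f : 𝓢(E, F)) (i : ℕ) {C r : ℝ} (hC : ∀ y, ‖y‖ ≤ r → ‖iteratedFDeriv ℝ (i + 1) f y‖ ≤ C)
    {x : E} (hx : ‖x‖ ≤ r) :
    ‖iteratedFDeriv ℝ i f x - iteratedFDeriv ℝ i f 0‖ ≤ C * ‖x‖ := by
  have := (convex_closedBall (0 : E) r).norm_image_sub_le_of_norm_fderiv_le (𝕜 := ℝ)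
    (f := iteratedFDeriv ℝ i f) (C := C) (x := 0) (y := x)
    (fun y _ => ((f.smooth ⊤).differentiable_iteratedFDeriv
      (mod_cast ENat.natCast_lt_top i)).differentiableAt)
    (fun y hy => by
      rw [norm_fderiv_iteratedFDeriv]
      exact hC y (by simpa using hy))
    (by simpa using (norm_nonneg x).trans hx) (by simpa using hx)
  simpa using this

/-- Taylor estimate for a Schwartz function all of whose derivatives of order `< R` vanish
at the origin. -/
theorem norm_iteratedFDeriv_le_pow {ψ : 𝓢(E, ℂ)} {R : ℕ}
    (h : ∀ m < R, iteratedFDeriv ℝ m ψ 0 = 0) (m : ℕ) (hm : m ≤ R) (x : E) :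
    ‖iteratedFDeriv ℝ (R - m) ψ x‖ ≤ SchwartzMap.seminorm ℝ 0 R ψ * ‖x‖ ^ m := by
  -- Induction downwards from the derivative of order R, with one use of the mean value inequality
  -- on the ball of radius ‖x‖ per step.
  induction m generalizing x with
  | zero => simpa using ψ.norm_iteratedFDeriv_le_seminorm ℝ R x
  | succ m ih =>
    have := norm_iteratedFDeriv_sub_le ψ (R - (m + 1)) (r := ‖x‖) (x := x)
      (C := SchwartzMap.seminorm ℝ 0 R ψ * ‖x‖ ^ m) (fun y hy => by
        rw [show R - (m + 1) + 1 = R - m by omega]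
        refine (ih (by omega) y).trans ?_
        gcongr) le_rfl
    rwa [h _ (by omega), sub_zero, mul_assoc, ← pow_succ] at this

theorem norm_iteratedFDeriv_comp_smul (ψ : 𝓢(E, ℂ)) (i : ℕ) {t : ℝ} (ht : 0 ≤ t) (x : E) :
    ‖iteratedFDeriv ℝ i (fun y => ψ (t • y)) x‖ = t ^ i * ‖iteratedFDeriv ℝ i ψ (t • x)‖ := by
  rw [iteratedFDeriv_comp_const_smul t (ψ.smooth i)]
  rw [norm_smul, norm_pow, Real.norm_of_nonneg ht]

theorem contDiff_comp_smul (ψ : 𝓢(E, ℂ)) (t : ℝ) : ContDiff ℝ ∞ fun x => ψ (t • x) :=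
  (ψ.smooth ⊤).comp (contDiff_const_smul t)

/-- For i ≤ R the chain rule gives t^i and Taylor's estimate a further t^(R-i)‖x‖^(R-i), whose
polynomial part η absorbs. For i ≥ R the chain rule suffices, as t ≤ 1. -/
theorem exists_seminorm_le_of_le_one {ψ η : 𝓢(E, ℂ)} {R : ℕ}
    (hψ : ∀ m < R, iteratedFDeriv ℝ m ψ 0 = 0) {g : Set.Ioc (0 : ℝ) 1 → 𝓢(E, ℂ)}
    (hg : ∀ t x, g t x = ψ ((t : ℝ) • x) * η x) (k l : ℕ) :
    ∃ C : ℝ, 0 ≤ C ∧ ∀ t, SchwartzMap.seminorm ℂ k l (g t) ≤ C * (t : ℝ) ^ R := by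
  refine exists_seminorm_mul_le (h := fun (t : Set.Ioc (0 : ℝ) 1) x => ψ ((t : ℝ) • x)) hg
    (fun t => contDiff_comp_smul ψ _) (fun t => pow_nonneg t.2.1.le R) (fun i => ?_) k l
  rcases le_total i R with hi | hi
  · refine ⟨SchwartzMap.seminorm ℝ 0 R ψ, R - i, apply_nonneg _ _, fun t x _ => ?_⟩
    have ht := t.2.1.le
    rw [norm_iteratedFDeriv_comp_smul ψ i ht]
    have := norm_iteratedFDeriv_le_pow hψ (R - i) (by omega) ((t : ℝ) • x)
    rw [Nat.sub_sub_self hi, norm_smul, Real.norm_of_nonneg ht] at this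
    grw [this, mul_pow]
    calc (t : ℝ) ^ i * (SchwartzMap.seminorm ℝ 0 R ψ * ((t : ℝ) ^ (R - i) * ‖x‖ ^ (R - i)))
        = SchwartzMap.seminorm ℝ 0 R ψ * (t : ℝ) ^ (i + (R - i)) * ‖x‖ ^ (R - i) := by
          rw [pow_add]; ring
      _ ≤ _ := by
          rw [Nat.add_sub_cancel' hi]
          gcongr
          linarith
  · refine ⟨SchwartzMap.seminorm ℝ 0 i ψ, 0, apply_nonneg _ _, fun t x _ => ?_⟩
    have ht := t.2.1.le
    rw [norm_iteratedFDeriv_comp_smul ψ i ht, pow_zero, mul_one, mul_comm]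
    exact mul_le_mul (ψ.norm_iteratedFDeriv_le_seminorm ℝ i _)
      (pow_le_pow_of_le_one ht t.2.2 hi) (by positivity) (apply_nonneg _ _)

/-- On the support of η one has ‖t x‖ ≥ tρ, so the decay of order i + N of the i-th derivative of ψ
pays for the factor t^i of the chain rule and leaves t^(-N). -/
theorem exists_seminorm_le_of_one_le (ψ : 𝓢(E, ℂ)) {η : 𝓢(E, ℂ)} {ρ : ℝ} (hρ : 0 < ρ)
    (hη : ∀ x ∈ tsupport η, ρ ≤ ‖x‖) (N : ℕ) {g : Set.Ici (1 : ℝ) → 𝓢(E, ℂ)}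
    (hg : ∀ t x, g t x = ψ ((t : ℝ) • x) * η x) (k l : ℕ) :
    ∃ C : ℝ, 0 ≤ C ∧ ∀ t, SchwartzMap.seminorm ℂ k l (g t) ≤ C * ((t : ℝ) ^ N)⁻¹ := by
  have ht0 (t : Set.Ici (1 : ℝ)) : (0 : ℝ) < t := one_pos.trans_le t.2
  refine exists_seminorm_mul_le (h := fun (t : Set.Ici (1 : ℝ)) x => ψ ((t : ℝ) • x)) hg
    (fun t => contDiff_comp_smul ψ _) (fun t => inv_nonneg.2 (pow_nonneg (ht0 t).le N))
    (fun i => ?_) k l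
  refine ⟨SchwartzMap.seminorm ℝ (i + N) i ψ / ρ ^ (i + N), 0, by positivity, fun t x hx => ?_⟩
  have ht := ht0 t
  have hx' := hη x hx
  rw [norm_iteratedFDeriv_comp_smul ψ i ht.le, pow_zero, mul_one]
  have := ψ.le_seminorm ℝ (i + N) i ((t : ℝ) • x)
  rw [norm_smul, Real.norm_of_nonneg ht.le] at this
  rw [← div_eq_mul_inv, div_div, le_div_iff₀ (by positivity)]
  calc (t : ℝ) ^ i * ‖iteratedFDeriv ℝ i ψ ((t : ℝ) • x)‖ * (ρ ^ (i + N) * (t : ℝ) ^ N)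
      = (t * ρ) ^ (i + N) * ‖iteratedFDeriv ℝ i ψ ((t : ℝ) • x)‖ := by
        rw [mul_pow, pow_add (t : ℝ)]; ring
    _ ≤ (t * ‖x‖) ^ (i + N) * ‖iteratedFDeriv ℝ i ψ ((t : ℝ) • x)‖ := by gcongr
    _ ≤ _ := this

/-- Every seminorm of the difference is O(t N): at order zero by the mean value inequality and χ(0)
= 1, at order i ≥ 1 because t^i ≤ t. -/
theorem tendsto_of_cutoff {χ ψ : 𝓢(E, ℂ)} (hχ : χ 0 = 1) {t : ℕ → ℝ}
    (ht0 : ∀ N, t N ∈ Set.Ioc (0 : ℝ) 1) (ht : Filter.Tendsto t Filter.atTop (nhds 0))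
    {g : ℕ → 𝓢(E, ℂ)} (hg : ∀ N x, g N x = χ (t N • x) * ψ x) :
    Filter.Tendsto g Filter.atTop (nhds ψ) := by
  rw [(schwartz_withSeminorms ℂ E ℂ).tendsto_nhds]
  have key : ∀ k l : ℕ, ∃ C : ℝ, 0 ≤ C ∧ ∀ N, SchwartzMap.seminorm ℂ k l (g N - ψ) ≤ C * t N := by
    intro k l
    refine exists_seminorm_mul_le (h := fun N x => χ (t N • x) - 1) (η := ψ)
      (fun N x => by simp [hg, sub_mul]) (fun N => (contDiff_comp_smul χ _).sub contDiff_const)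
      (fun N => (ht0 N).1.le) (fun i => ?_) k l
    rcases Nat.eq_zero_or_pos i with rfl | hi
    · refine ⟨SchwartzMap.seminorm ℝ 0 1 χ, 1, apply_nonneg _ _, fun N x _ => ?_⟩
      have h1 := norm_iteratedFDeriv_sub_le χ 0 (x := t N • x)
        (fun y _ => χ.norm_iteratedFDeriv_le_seminorm ℝ 1 y) le_rfl
      rw [iteratedFDeriv_zero_eq_comp, Function.comp_apply, Function.comp_apply, ← map_sub,
        LinearIsometryEquiv.norm_map, hχ, norm_smul, Real.norm_of_nonneg (ht0 N).1.le] at h1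
      rw [norm_iteratedFDeriv_zero, pow_one]
      refine h1.trans ?_
      rw [← mul_assoc]
      have := (ht0 N).1.le
      gcongr
      linarith
    · refine ⟨SchwartzMap.seminorm ℝ 0 i χ, 0, apply_nonneg _ _, fun N x _ => ?_⟩
      have h0 := (ht0 N).1.le
      have hs : iteratedFDeriv ℝ i (fun x => χ (t N • x) - 1) x =
          iteratedFDeriv ℝ i (fun x => χ (t N • x)) x := by
        change iteratedFDeriv ℝ i ((fun x => χ (t N • x)) - fun _ => (1 : ℂ)) x = _
        rw [iteratedFDeriv_sub_apply ((contDiff_comp_smul χ _).contDiffAt.of_le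
          (by exact_mod_cast le_top)) contDiffAt_const, iteratedFDeriv_const_of_ne hi.ne']
        simp
      rw [hs, norm_iteratedFDeriv_comp_smul χ i h0, pow_zero, mul_one, mul_comm]
      gcongr
      · exact χ.norm_iteratedFDeriv_le_seminorm ℝ i _
      · exact pow_le_of_le_one h0 (ht0 N).2 hi.ne'
  rintro ⟨k, l⟩ ε hε
  obtain ⟨C, hC, hCg⟩ := key k l
  have hlim : Filter.Tendsto (fun N => C * t N) Filter.atTop (nhds 0) := by
    simpa using ht.const_mul C
  filter_upwards [hlim.eventually_lt_const hε] with N hN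
  exact (hCg N).trans_lt hN

/-- The weighted `L₁` norm of a Schwartz function is dominated by a continuous seminorm. -/
theorem exists_lintegral_one_add_norm_pow_le [MeasurableSpace E] [BorelSpace E]
    [FiniteDimensional ℝ E] (μ : Measure E) [μ.HasTemperateGrowth] (A : ℕ) :
    ∃ (C : ℝ) (q : Seminorm ℂ 𝓢(E, ℂ)), 0 ≤ C ∧ Continuous q ∧ ∀ g : 𝓢(E, ℂ),
      ∫⁻ z, ‖g z‖ₑ * ENNReal.ofReal ((1 + ‖z‖) ^ A) ∂μ ≤ ENNReal.ofReal (C * q g) := by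
  set M := μ.integrablePower
  set I : ℝ := ∫ z : E, (1 + ‖z‖) ^ (-(M : ℝ)) ∂μ
  have hI : 0 ≤ I := integral_nonneg fun z => by positivity
  set p : Seminorm ℂ 𝓢(E, ℂ) := (Finset.Iic (A + M, 0)).sup (schwartzSeminormFamily ℂ E ℂ)
  have hp : Continuous p :=
    Seminorm.continuous_of_le (Seminorm.continuous_finsetSum fun i _ =>
      (schwartz_withSeminorms ℂ E ℂ).continuous_seminorm i) (Seminorm.finset_sup_le_sum _ _)
  refine ⟨2 ^ (A + M) * I, p, by positivity, hp, fun g => ?_⟩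
  -- The M extra powers of the weight produce the integrable factor (1 + ‖z‖)^(-M).
  have hb : ∀ z, ‖g z‖ * (1 + ‖z‖) ^ A ≤ 2 ^ (A + M) * p g * (1 + ‖z‖) ^ (-(M : ℝ)) := by
    intro z
    have := SchwartzMap.one_add_le_sup_seminorm_apply (𝕜 := ℂ) (m := (A + M, 0)) (k := A + M)
      (n := 0) le_rfl le_rfl g z
    rw [norm_iteratedFDeriv_zero] at this
    rw [Real.rpow_neg (by positivity), Real.rpow_natCast, ← div_eq_mul_inv,
      le_div_iff₀ (by positivity)]
    refine le_trans (le_of_eq ?_) this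
    rw [pow_add]; ring
  have hint := Measure.integrable_pow_neg_integrablePower μ
  calc ∫⁻ z, ‖g z‖ₑ * ENNReal.ofReal ((1 + ‖z‖) ^ A) ∂μ
      ≤ ∫⁻ z, ENNReal.ofReal (2 ^ (A + M) * p g * (1 + ‖z‖) ^ (-(M : ℝ))) ∂μ := by
        refine lintegral_mono fun z => ?_
        rw [← ofReal_norm, ← ENNReal.ofReal_mul (norm_nonneg _)]
        exact ENNReal.ofReal_le_ofReal (hb z)
    _ = ENNReal.ofReal (∫ z, 2 ^ (A + M) * p g * (1 + ‖z‖) ^ (-(M : ℝ)) ∂μ) := by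
        rw [ofReal_integral_eq_lintegral_ofReal (hint.const_mul _)]
        exact Filter.Eventually.of_forall fun z =>
          mul_nonneg (mul_nonneg (by positivity) (apply_nonneg _ _)) (by positivity)
    _ = _ := by rw [integral_const_mul]; congr 1; ring

end Schwartz

/-- Bounded continuous functions with values in a normed group, with the metric derived from
the norm. -/
abbrev BddCont (X F : Type*) [TopologicalSpace X] [NormedAddCommGroup F] := X →ᵇ F

/-! ### Embedding the Schwartz space into Banach spaces of weighted jets. -/

section Jets

variable {E : Type*} [NormedAddCommGroup E] [NormedSpace ℝ E]

/-- The map `f ↦ (x ↦ ‖x‖ ^ k D^l f(x))` into bounded continuous functions. -/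
noncomputable def weightedJet (k l : ℕ) : 𝓢(E, ℂ) →ₗ[ℂ] BddCont E (E [×l]→L[ℝ] ℂ) where
  toFun f := BoundedContinuousFunction.ofNormedAddCommGroup
    (fun x => ‖x‖ ^ k • iteratedFDeriv ℝ l f x)
    ((continuous_norm.pow k).smul ((f.smooth ⊤).continuous_iteratedFDeriv
      (by exact_mod_cast le_top)))
    (SchwartzMap.seminorm ℝ k l f) fun x => by
      rw [norm_smul, norm_pow, norm_norm]
      exact f.le_seminorm ℝ k l x
  map_add' f g := by
    ext1 x
    change ‖x‖ ^ k • iteratedFDeriv ℝ l ((f : E → ℂ) + (g : E → ℂ)) x = ‖x‖ ^ k • _ + ‖x‖ ^ k • _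
    rw [iteratedFDeriv_add_apply (f.contDiffAt l) (g.contDiffAt l), smul_add]
  map_smul' c f := by
    ext1 x
    change ‖x‖ ^ k • iteratedFDeriv ℝ l (c • (f : E → ℂ)) x = c • ‖x‖ ^ k • _
    rw [iteratedFDeriv_const_smul_apply (f.contDiffAt l), smul_comm]

theorem weightedJet_apply (k l : ℕ) (f : 𝓢(E, ℂ)) (x : E) :
    weightedJet k l f x = ‖x‖ ^ k • iteratedFDeriv ℝ l f x := rfl

theorem seminorm_le_norm_weightedJet (k l : ℕ) (f : 𝓢(E, ℂ)) :
    SchwartzMap.seminorm ℂ k l f ≤ ‖weightedJet k l f‖ := by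
  refine SchwartzMap.seminorm_le_bound ℂ k l f (norm_nonneg _) fun x => ?_
  have := (weightedJet k l f).norm_coe_le_norm x
  rwa [weightedJet_apply, norm_smul, norm_pow, norm_norm] at this

theorem iteratedFDeriv_compSubConstCLM (l : ℕ) (f : 𝓢(E, ℂ)) (z x : E) :
    iteratedFDeriv ℝ l (SchwartzMap.compSubConstCLM ℂ z f) x = iteratedFDeriv ℝ l f (x - z) :=
  iteratedFDeriv_comp_sub l z x

theorem exists_norm_pow_mul_iteratedFDeriv_sub_le (f : 𝓢(E, ℂ)) (k l : ℕ) :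
    ∃ C : ℝ, 0 ≤ C ∧ ∀ x z, ‖x‖ ^ k * ‖iteratedFDeriv ℝ l f (x - z)‖ ≤ C * (1 + ‖z‖) ^ k := by
  obtain ⟨C, hC, h⟩ := exists_one_add_norm_pow_mul_le f k l
  refine ⟨C, hC, fun x z => ?_⟩
  have hx : ‖x‖ ≤ (1 + ‖x - z‖) * (1 + ‖z‖) := by
    have := norm_sub_norm_le x z
    nlinarith [norm_nonneg z, norm_nonneg (x - z)]
  calc ‖x‖ ^ k * ‖iteratedFDeriv ℝ l f (x - z)‖
      ≤ ((1 + ‖x - z‖) * (1 + ‖z‖)) ^ k * ‖iteratedFDeriv ℝ l f (x - z)‖ := by gcongr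
    _ = ((1 + ‖x - z‖) ^ k * ‖iteratedFDeriv ℝ l f (x - z)‖) * (1 + ‖z‖) ^ k := by
        rw [mul_pow]; ring
    _ ≤ _ := by gcongr; exact h _

theorem exists_norm_weightedJet_translate_le (f : 𝓢(E, ℂ)) (k l : ℕ) :
    ∃ C : ℝ, 0 ≤ C ∧
      ∀ z, ‖weightedJet k l (SchwartzMap.compSubConstCLM ℂ z f)‖ ≤ C * (1 + ‖z‖) ^ k := by
  obtain ⟨C, hC, h⟩ := exists_norm_pow_mul_iteratedFDeriv_sub_le f k l
  refine ⟨C, hC, fun z => (BoundedContinuousFunction.norm_le (by positivity)).2 fun x => ?_⟩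
  rw [weightedJet_apply, norm_smul, norm_pow, norm_norm, iteratedFDeriv_compSubConstCLM]
  exact h x z

theorem norm_smul_comp_sub_le {F : Type*} [NormedAddCommGroup F] [NormedSpace ℝ F] {T : E → F}
    (hT : Differentiable ℝ T) {c K r : ℝ} (hc : 0 ≤ c) {x z z₀ : E}
    (hK : ∀ ζ ∈ Metric.ball z₀ r, c * ‖fderiv ℝ T (x - ζ)‖ ≤ K) (hz : z ∈ Metric.ball z₀ r) :
    ‖c • T (x - z) - c • T (x - z₀)‖ ≤ K * ‖z - z₀‖ := by
  refine (convex_ball z₀ r).norm_image_sub_le_of_norm_hasFDerivWithin_le (𝕜 := ℝ)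
    (f := fun ζ => c • T (x - ζ)) (f' := fun ζ => c • (-fderiv ℝ T (x - ζ)))
    (fun ζ _ => ?_) (fun ζ hζ => ?_)
    (Metric.mem_ball_self (Metric.pos_of_mem_ball hz)) hz
  · have := ((hT (x - ζ)).hasFDerivAt.comp ζ ((hasFDerivAt_id ζ).const_sub x)).const_smul c
    rw [ContinuousLinearMap.comp_neg, ContinuousLinearMap.comp_id] at this
    exact this.hasFDerivWithinAt
  · rw [norm_smul, norm_neg, Real.norm_of_nonneg hc]
    exact hK ζ hζ

/-- Translation is locally Lipschitz in the jet norm, with constant controlled by the derivatives of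
order l + 1. Continuity supplies the measurability needed for a Bochner integral. -/
theorem continuous_weightedJet_translate (f : 𝓢(E, ℂ)) (k l : ℕ) :
    Continuous fun z => weightedJet k l (SchwartzMap.compSubConstCLM ℂ z f) := by
  obtain ⟨C, hC, h⟩ := exists_norm_pow_mul_iteratedFDeriv_sub_le f k (l + 1)
  refine continuous_iff_continuousAt.2 fun z₀ => ?_
  set K := C * (2 + ‖z₀‖) ^ k
  have hK : 0 ≤ K := by positivity
  refine continuousAt_of_locally_lipschitz (r := 1) one_pos K fun z hz => ?_
  rw [dist_eq_norm, dist_eq_norm, ← map_sub]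
  refine (BoundedContinuousFunction.norm_le (by positivity)).2 fun x => ?_
  rw [map_sub, BoundedContinuousFunction.sub_apply, weightedJet_apply, weightedJet_apply,
    iteratedFDeriv_compSubConstCLM, iteratedFDeriv_compSubConstCLM]
  refine norm_smul_comp_sub_le ((f.smooth ⊤).differentiable_iteratedFDeriv
    (mod_cast ENat.natCast_lt_top l)) (by positivity) (fun ζ hζ => ?_) hz
  rw [norm_fderiv_iteratedFDeriv]
  refine (h x ζ).trans ?_
  have hζ' : ‖ζ‖ ≤ 1 + ‖z₀‖ := by
    have := norm_sub_norm_le ζ z₀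
    rw [mem_ball_iff_norm] at hζ
    linarith
  simp only [K]
  gcongr C * ?_ ^ k
  linarith

/-- A tempered distribution factors through finitely many weighted jets. -/
theorem exists_strongDual_weightedJet (F : 𝓢(E, ℂ) →L[ℂ] ℂ) :
    ∃ (s : Finset (ℕ × ℕ)) (L : StrongDual ℂ ((i : s) → BddCont E (E [×i.1.2]→L[ℝ] ℂ))),
      ∀ φ, L (fun i => weightedJet i.1.1 i.1.2 φ) = F φ := by
  obtain ⟨s, C, -, hC⟩ := Seminorm.bound_of_continuous (schwartz_withSeminorms ℂ E ℂ)
    ((normSeminorm ℂ ℂ).comp (F : 𝓢(E, ℂ) →ₗ[ℂ] ℂ)) (continuous_norm.comp F.continuous)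
  let J : 𝓢(E, ℂ) →ₗ[ℂ] ((i : s) → BddCont E (E [×i.1.2]→L[ℝ] ℂ)) :=
    LinearMap.pi fun i => weightedJet i.1.1 i.1.2
  have hJ : ∀ φ, ‖F φ‖ ≤ C * ‖J φ‖ := fun φ => by
    refine (hC φ).trans ?_
    change (C : ℝ) * (s.sup (schwartzSeminormFamily ℂ E ℂ)) φ ≤ _
    gcongr
    refine Seminorm.finset_sup_apply_le (norm_nonneg _) fun i hi => ?_
    exact (seminorm_le_norm_weightedJet i.1 i.2 φ).trans (norm_le_pi_norm (J φ) ⟨i, hi⟩)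
  -- The seminorm bound lets F descend to the range of J as a bounded functional, which Hahn–Banach
  -- extends to the whole product.
  have hker : LinearMap.ker J ≤ LinearMap.ker (F : 𝓢(E, ℂ) →ₗ[ℂ] ℂ) := fun φ hφ => by
    have h0 : J φ = 0 := hφ
    have := hJ φ
    rw [h0, norm_zero, mul_zero] at this
    exact norm_le_zero_iff.1 this
  let f₀ : LinearMap.range J →ₗ[ℂ] ℂ :=
    (LinearMap.ker J).liftQ (F : 𝓢(E, ℂ) →ₗ[ℂ] ℂ) hker ∘ₗ J.quotKerEquivRange.symm
  have hf₀ : ∀ φ, f₀ ⟨J φ, LinearMap.mem_range_self J φ⟩ = F φ := fun φ => by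
    simp only [f₀, LinearMap.comp_apply, LinearEquiv.coe_coe]
    rw [LinearMap.quotKerEquivRange_symm_apply_image J φ (LinearMap.mem_range_self J φ)]
    rfl
  let f₁ : StrongDual ℂ (LinearMap.range J) := f₀.mkContinuous C fun y => by
    obtain ⟨_, φ, rfl⟩ := y
    rw [hf₀]
    exact hJ φ
  obtain ⟨L, hL, -⟩ := exists_extension_norm_eq (LinearMap.range J) f₁
  exact ⟨s, L, fun φ => (hL ⟨J φ, LinearMap.mem_range_self J φ⟩).trans (hf₀ φ)⟩

end Jets

/-! ### Tempered distributions applied to convolutions and products. -/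

section Convolution

variable {V : Type*} [NormedAddCommGroup V] [InnerProductSpace ℝ V] [FiniteDimensional ℝ V]
  [MeasurableSpace V] [BorelSpace V]

/-- The convolution of two Schwartz functions. -/
noncomputable def schwartzConv (f g : 𝓢(V, ℂ)) : 𝓢(V, ℂ) :=
  SchwartzMap.convolution (ContinuousLinearMap.mul ℂ ℂ) f g

theorem schwartzConv_apply (f g : 𝓢(V, ℂ)) (x : V) :
    schwartzConv f g x = ∫ z, f z * g (x - z) :=
  SchwartzMap.convolution_apply (ContinuousLinearMap.mul ℂ ℂ) f g x

theorem fourier_schwartzConv (f g : 𝓢(V, ℂ)) :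
    𝓕 (schwartzConv f g) = schwartzMul (𝓕 f) (𝓕 g) :=
  SchwartzMap.fourier_convolution (ContinuousLinearMap.mul ℂ ℂ) f g

theorem fourier_injective : Function.Injective (𝓕 : 𝓢(V, ℂ) → 𝓢(V, ℂ)) := fun f g h => by
  simpa using congrArg (𝓕⁻ : 𝓢(V, ℂ) → 𝓢(V, ℂ)) h

/-- On the Fourier side both operations are multiplications, which commute. -/
theorem lineDerivOp_schwartzConv (f g : 𝓢(V, ℂ)) (m : V) :
    ∂_{m} (schwartzConv f g) = schwartzConv f (∂_{m} g) := by
  apply fourier_injective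
  rw [SchwartzMap.fourier_lineDerivOp_eq, fourier_schwartzConv, fourier_schwartzConv,
    SchwartzMap.fourier_lineDerivOp_eq]
  have hm : (fun x : V => inner ℝ x m).HasTemperateGrowth :=
    Function.hasTemperateGrowth_inner_left m
  ext x
  simp only [smul_apply, SchwartzMap.smulLeftCLM_apply_apply hm, schwartzMul_apply,
    smul_eq_mul, Complex.real_smul]
  ring

theorem iteratedLineDerivOp_schwartzConv (f g : 𝓢(V, ℂ)) {l : ℕ} (m : Fin l → V) :
    ∂^{m} (schwartzConv f g) = schwartzConv f (∂^{m} g) := by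
  induction l with
  | zero => rfl
  | succ l ih =>
    rw [LineDeriv.iteratedLineDerivOp_succ_left, ih, lineDerivOp_schwartzConv]
    rfl

/-- A tempered distribution commutes with the integral defining a convolution. -/
theorem apply_schwartzConv (F : 𝓢(V, ℂ) →L[ℂ] ℂ) (f g : 𝓢(V, ℂ)) :
    F (schwartzConv f g) = ∫ z, f z * F (SchwartzMap.compSubConstCLM ℂ z g) := by
  obtain ⟨s, L, hL⟩ := exists_strongDual_weightedJet F
  set J : V → (i : s) → BddCont V (V [×i.1.2]→L[ℝ] ℂ) :=
    fun z i => weightedJet i.1.1 i.1.2 (SchwartzMap.compSubConstCLM ℂ z g)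
  have hcont : Continuous J := continuous_pi fun i => continuous_weightedJet_translate g _ _
  -- The jet norms of translates of g grow polynomially in z, and the decay of f outweighs this.
  have hint : Integrable fun z => f z • J z := by
    refine Integrable.of_eval fun i => ?_
    obtain ⟨C, hC, hCz⟩ := exists_norm_weightedJet_translate_le g i.1.1 i.1.2
    obtain ⟨D, hD, hDz⟩ := exists_one_add_norm_pow_mul_le f
      (i.1.1 + (volume : Measure V).integrablePower) 0
    have hM := Measure.integrable_pow_neg_integrablePower (volume : Measure V)
    refine (hM.const_mul (C * D)).mono'
      (f.continuous.smul ((continuous_apply i).comp hcont)).aestronglyMeasurable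
      (Filter.Eventually.of_forall fun z => ?_)
    change ‖f z • weightedJet i.1.1 i.1.2 (SchwartzMap.compSubConstCLM ℂ z g)‖ ≤ _
    rw [norm_smul, Real.rpow_neg (by positivity), Real.rpow_natCast, ← div_eq_mul_inv,
      le_div_iff₀ (by positivity)]
    have h := hDz z
    rw [norm_iteratedFDeriv_zero, pow_add] at h
    grw [hCz z]
    calc ‖f z‖ * (C * (1 + ‖z‖) ^ i.1.1) * (1 + ‖z‖) ^ (volume : Measure V).integrablePower
        = C * ((1 + ‖z‖) ^ i.1.1 * (1 + ‖z‖) ^ (volume : Measure V).integrablePower * ‖f z‖) := by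
          ring
      _ ≤ C * D := by gcongr
  -- The identity between Banach-space-valued objects is tested by evaluating at a component i, a
  -- point x and directions m, where it says that derivatives of a convolution fall on g.
  have hJ : (fun i : s => weightedJet i.1.1 i.1.2 (schwartzConv f g)) = ∫ z, f z • J z := by
    funext i
    ext1 x
    ext1 m
    let e : ((i : s) → BddCont V (V [×i.1.2]→L[ℝ] ℂ)) →L[ℝ] ℂ :=
      (ContinuousMultilinearMap.apply ℝ (fun _ : Fin i.1.2 => V) ℂ m).comp
        ((BoundedContinuousFunction.evalCLM ℝ x).comp (ContinuousLinearMap.proj i))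
    change _ = e (∫ z, f z • J z)
    rw [← e.integral_comp_comm hint]
    have he : ∀ z, e (f z • J z) = ‖x‖ ^ i.1.1 • (f z * (∂^{m} g) (x - z)) := by
      intro z
      change (f z • ‖x‖ ^ i.1.1 •
        iteratedFDeriv ℝ i.1.2 (SchwartzMap.compSubConstCLM ℂ z g) x) m = _
      rw [iteratedFDeriv_compSubConstCLM, SchwartzMap.iteratedLineDerivOp_eq_iteratedFDeriv,
        smul_comm]
      rfl
    simp_rw [he]
    rw [integral_smul, ← schwartzConv_apply, ← iteratedLineDerivOp_schwartzConv,
      SchwartzMap.iteratedLineDerivOp_eq_iteratedFDeriv]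
    rfl
  rw [← hL, hJ, ← L.integral_comp_comm hint]
  refine integral_congr_ae (Filter.Eventually.of_forall fun z => ?_)
  simp only [map_smul, smul_eq_mul]
  rw [← hL]

/-- Multiplication of a Schwartz function by the character `x ↦ e ^ (2πi ⟨z, x⟩)`. -/
noncomputable def modulate (z : V) (f : 𝓢(V, ℂ)) : 𝓢(V, ℂ) :=
  𝓕⁻ (SchwartzMap.compSubConstCLM ℂ z (𝓕 f))

theorem modulate_apply (z : V) (f : 𝓢(V, ℂ)) (x : V) :
    modulate z f x = Real.fourierChar (inner ℝ z x) • f x := by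
  rw [modulate, SchwartzMap.fourierInv_coe, Real.fourierInv_eq]
  simp only [SchwartzMap.compSubConstCLM_apply]
  rw [← integral_add_right_eq_self _ z]
  simp only [add_sub_cancel_right, inner_add_left, AddChar.map_add_eq_mul, mul_comm,
    mul_smul]
  simp only [Circle.smul_def]
  rw [integral_smul]
  have h : f x = 𝓕⁻ (𝓕 f) x := by simp
  conv_rhs => rw [h, SchwartzMap.fourierInv_coe, Real.fourierInv_eq]
  simp only [Circle.smul_def]

/-- Representation of a product tested against a tempered distribution as a superposition of
modulations. -/
theorem apply_schwartzMul (F : 𝓢(V, ℂ) →L[ℂ] ℂ) (g φ : 𝓢(V, ℂ)) :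
    F (schwartzMul g φ) = ∫ z, (𝓕 g) z * F (modulate z φ) := by
  -- Composing F with the inverse Fourier transform turns the product into a convolution of Fourier
  -- transforms.
  have h := apply_schwartzConv (F ∘L FourierTransform.fourierInvCLM ℂ 𝓢(V, ℂ)) (𝓕 g) (𝓕 φ)
  have hconv : 𝓕⁻ (schwartzConv (𝓕 g) (𝓕 φ)) = schwartzMul g φ := by
    ext x
    have h1 : ∀ u : 𝓢(V, ℂ), (𝓕⁻ u) x = (𝓕 u) (-x) := fun u => by
      rw [SchwartzMap.fourierInv_apply_eq]; simp
    rw [h1, fourier_schwartzConv, schwartzMul_apply, schwartzMul_apply, ← h1, ← h1]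
    simp
  simpa [hconv, modulate] using h

end Convolution

/-! ### Convolution with a distribution, as a functional of the symbol. -/

section Distributions

variable {n : ℕ}

theorem MomentCondition.iteratedFDeriv_eq_zero {R : ℕ} {ψ : 𝓢(Rn n, ℂ)}
    (h : MomentCondition R ψ) : ∀ m < R, iteratedFDeriv ℝ m ψ 0 = 0 := by
  intro m hm
  refine ContinuousMultilinearMap.toMultilinearMap_injective ?_
  refine Module.Basis.ext_multilinear
    (fun _ => (EuclideanSpace.basisFun (Fin n) ℝ).toBasis) fun v => ?_
  have := h m hm v
  rw [SchwartzMap.iteratedLineDerivOp_eq_iteratedFDeriv] at this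
  simpa using this

theorem continuous_dilate (t : ℝ) (ht : t ≠ 0) :
    Continuous fun h : 𝓢(Rn n, ℂ) => dilate t ht h :=
  (SchwartzMap.compCLMOfContinuousLinearEquiv ℂ
    (ContinuousLinearEquiv.smulLeft (R₁ := ℝ) (M₁ := Rn n) (Units.mk0 t ht))).continuous

/-- The map `h ↦ (ĥ * f)(y)`. -/
noncomputable def convCLM (f : 𝓢'(Rn n, ℂ)) (y : Rn n) : 𝓢(Rn n, ℂ) →L[ℂ] ℂ where
  toFun h := conv (fourierHat h) f y
  map_add' g h := by
    have : SchwartzMap.compSubConstCLM ℂ y (dilate (-1) (by norm_num) (fourierHat (g + h))) =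
        SchwartzMap.compSubConstCLM ℂ y (dilate (-1) (by norm_num) (fourierHat g)) +
        SchwartzMap.compSubConstCLM ℂ y (dilate (-1) (by norm_num) (fourierHat h)) := by
      simp only [fourierHat, dilate, FourierTransform.fourier_add, map_add, smul_add, map_smul]
    simp only [conv, this, map_add]
  map_smul' c h := by
    have : SchwartzMap.compSubConstCLM ℂ y (dilate (-1) (by norm_num) (fourierHat (c • h))) =
        c • SchwartzMap.compSubConstCLM ℂ y (dilate (-1) (by norm_num) (fourierHat h)) := by
      simp only [fourierHat, dilate, FourierTransform.fourier_smul, map_smul]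
      exact smul_comm _ _ _
    simp only [conv, this, map_smul, RingHom.id_apply]
  cont := by
    have hF : Continuous fun h : 𝓢(Rn n, ℂ) => fourierHat h := by
      have h1 : Continuous fun h : 𝓢(Rn n, ℂ) =>
          dilate ((2 * Real.pi)⁻¹) (by positivity) (𝓕 h) :=
        (continuous_dilate _ _).comp (FourierTransform.fourierCLM ℂ 𝓢(Rn n, ℂ)).continuous
      exact h1.const_smul (((2 * Real.pi) ^ (-(n : ℝ) / 2) : ℝ) : ℂ)
    exact f.continuous.comp ((SchwartzMap.compSubConstCLM ℂ y).continuous.comp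
      ((continuous_dilate _ _).comp hF))

theorem convCLM_apply (f : 𝓢'(Rn n, ℂ)) (y : Rn n) (h : 𝓢(Rn n, ℂ)) :
    convCLM f y h = conv (fourierHat h) f y := rfl

/-- Modulation becomes translation; the factor 2π comes from the two Fourier normalizations, s from
the dilation. -/
theorem fourierHat_dilate_modulate {s : ℝ} (hs : s ≠ 0) (z x : Rn n) (φ : 𝓢(Rn n, ℂ)) :
    fourierHat (dilate s hs (modulate z φ)) x =
      fourierHat (dilate s hs φ) (x - (2 * Real.pi * s) • z) := by
  rw [fourierHat_apply, fourierHat_apply]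
  congr 2
  funext ξ
  rw [dilate_apply, dilate_apply, modulate_apply, Circle.smul_def, Real.fourierChar_apply,
    smul_eq_mul, ← mul_assoc, ← Complex.exp_add, inner_sub_left, inner_smul_left, inner_smul_right]
  congr 2
  simp only [conj_trivial]
  push_cast
  ring

theorem convCLM_dilate_modulate (f : 𝓢'(Rn n, ℂ)) (y z : Rn n) {s : ℝ} (hs : s ≠ 0)
    (φ : 𝓢(Rn n, ℂ)) :
    convCLM f y (dilate s hs (modulate z φ)) =
      convCLM f (y - (2 * Real.pi * s) • z) (dilate s hs φ) := by
  rw [convCLM_apply, convCLM_apply, conv, conv]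
  congr 1
  ext x
  rw [conv_test_apply, conv_test_apply, fourierHat_dilate_modulate]
  congr 1
  abel

theorem convCLM_dilate_schwartzMul (f : 𝓢'(Rn n, ℂ)) (y : Rn n) {s : ℝ} (hs : s ≠ 0)
    (g φ : 𝓢(Rn n, ℂ)) :
    convCLM f y (dilate s hs (schwartzMul g φ)) =
      ∫ z, (𝓕 g) z * convCLM f (y - (2 * Real.pi * s) • z) (dilate s hs φ) := by
  simp_rw [← convCLM_dilate_modulate]
  exact apply_schwartzMul (convCLM f y ∘L SchwartzMap.compCLMOfContinuousLinearEquiv ℂ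
    (ContinuousLinearEquiv.smulLeft (R₁ := ℝ) (M₁ := Rn n) (Units.mk0 s hs))) g φ

theorem one_add_norm_sub_rpow_le {E : Type*} [SeminormedAddCommGroup E] {a : ℝ} (ha : 0 ≤ a)
    {A : ℕ} (hA : a ≤ A) (u v : E) :
    1 + ‖u - v‖ ^ a ≤ 2 * (1 + ‖u‖ ^ a) * (1 + ‖v‖) ^ A := by
  have h1 : (1 + ‖v‖) ^ a ≤ (1 + ‖v‖) ^ A := by
    rw [← Real.rpow_natCast]
    exact Real.rpow_le_rpow_of_exponent_le (by linarith [norm_nonneg v]) hA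
  have h2 : 1 ≤ (1 + ‖v‖) ^ a := Real.one_le_rpow (by linarith [norm_nonneg v]) ha
  have hu : 0 ≤ ‖u‖ ^ a := by positivity
  have h3 : ‖u - v‖ ^ a ≤ (1 + ‖u‖ ^ a) * (1 + ‖v‖) ^ a := by
    rcases le_total ‖u‖ 1 with h | h
    · calc ‖u - v‖ ^ a ≤ (1 + ‖v‖) ^ a := by
            gcongr
            exact (norm_sub_le u v).trans (by gcongr)
        _ ≤ (1 + ‖u‖ ^ a) * (1 + ‖v‖) ^ a := le_mul_of_one_le_left (by positivity) (by linarith)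
    · calc ‖u - v‖ ^ a ≤ (‖u‖ * (1 + ‖v‖)) ^ a := by
            gcongr
            refine (norm_sub_le u v).trans ?_
            nlinarith [norm_nonneg v]
        _ = ‖u‖ ^ a * (1 + ‖v‖) ^ a := Real.mul_rpow (norm_nonneg _) (by positivity)
        _ ≤ _ := by gcongr; linarith
  nlinarith

/-- The weighted `L₁` norm of the Fourier transform. -/
noncomputable def fourierWeight (A : ℕ) (g : 𝓢(Rn n, ℂ)) : ℝ≥0∞ :=
  ∫⁻ z, ‖(𝓕 g) z‖ₑ * ENNReal.ofReal ((1 + ‖z‖) ^ A)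

/-- Moving from y to y - 2πs z changes the Peetre denominator by at most a power of 1 + ‖z‖, because
σs stays bounded. In the application σ = 2^j and s is the j-th dyadic scale. -/
theorem enorm_convCLM_dilate_schwartzMul_le (f : 𝓢'(Rn n, ℂ)) (x y : Rn n) {s σ a : ℝ}
    (hs : 0 < s) (hσ : 0 ≤ σ) (hσs : σ * s ≤ 2) (ha : 0 ≤ a) {A : ℕ} (hA : a ≤ A)
    (g φ : 𝓢(Rn n, ℂ)) {P : ℝ≥0∞}
    (hP : ∀ y', ‖convCLM f y' (dilate s hs.ne' φ)‖ₑ ≤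
      P * ENNReal.ofReal (1 + ‖σ • (y' - x)‖ ^ a)) :
    ‖convCLM f y (dilate s hs.ne' (schwartzMul g φ))‖ₑ ≤
      ENNReal.ofReal (2 * 16 ^ A) * fourierWeight A g * P *
        ENNReal.ofReal (1 + ‖σ • (y - x)‖ ^ a) := by
  have hz : ∀ z : Rn n, 1 + ‖σ • (y - (2 * Real.pi * s) • z - x)‖ ^ a ≤
      2 * 16 ^ A * (1 + ‖σ • (y - x)‖ ^ a) * (1 + ‖z‖) ^ A := by
    intro z
    have h1 : σ • (y - (2 * Real.pi * s) • z - x) =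
        σ • (y - x) - (2 * Real.pi * (σ * s)) • z := by
      rw [sub_right_comm, smul_sub, smul_smul]
      congr 2
      ring
    -- Here 2πσs ≤ 4π < 15, so 1 + 15‖z‖ ≤ 16(1 + ‖z‖), whence the constant 16^A.
    have h2 : ‖(2 * Real.pi * (σ * s)) • z‖ ≤ 15 * ‖z‖ := by
      rw [norm_smul, Real.norm_of_nonneg (by positivity)]
      gcongr
      nlinarith [Real.pi_lt_d2, Real.pi_pos, mul_nonneg hσ hs.le]
    rw [h1]
    refine (one_add_norm_sub_rpow_le ha hA _ _).trans ?_
    calc 2 * (1 + ‖σ • (y - x)‖ ^ a) * (1 + ‖(2 * Real.pi * (σ * s)) • z‖) ^ A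
        ≤ 2 * (1 + ‖σ • (y - x)‖ ^ a) * (16 * (1 + ‖z‖)) ^ A := by
          gcongr
          linarith [norm_nonneg z]
      _ = _ := by rw [mul_pow]; ring
  have hK : (0 : ℝ) ≤ 2 * 16 ^ A := by positivity
  generalize (2 * 16 ^ A : ℝ) = K at hz hK ⊢
  have hmeas : Measurable fun z : Rn n => ‖(𝓕 g) z‖ₑ * ENNReal.ofReal ((1 + ‖z‖) ^ A) := by
    have := (𝓕 g).continuous
    fun_prop
  set T := ENNReal.ofReal (1 + ‖σ • (y - x)‖ ^ a)
  have h1 : ∀ z, ‖convCLM f (y - (2 * Real.pi * s) • z) (dilate s hs.ne' φ)‖ₑ ≤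
      P * (ENNReal.ofReal K * T * ENNReal.ofReal ((1 + ‖z‖) ^ A)) := by
    intro z
    rw [← ENNReal.ofReal_mul hK, ← ENNReal.ofReal_mul (by positivity)]
    exact (hP _).trans (by gcongr; exact hz z)
  have h2 : ∀ z, ‖(𝓕 g) z * convCLM f (y - (2 * Real.pi * s) • z) (dilate s hs.ne' φ)‖ₑ ≤
      (‖(𝓕 g) z‖ₑ * ENNReal.ofReal ((1 + ‖z‖) ^ A)) * (ENNReal.ofReal K * P * T) := by
    intro z
    rw [enorm_mul]
    exact (mul_le_mul' le_rfl (h1 z)).trans (le_of_eq (by ring))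
  rw [convCLM_dilate_schwartzMul]
  refine (enorm_integral_le_lintegral_enorm _).trans ((lintegral_mono h2).trans (le_of_eq ?_))
  rw [lintegral_mul_const _ hmeas, fourierWeight]
  ring

theorem exists_fourierWeight_le (A : ℕ) {ι : Type*} {g : ι → 𝓢(Rn n, ℂ)} {θ : ι → ℝ}
    (hθ : ∀ t, 0 ≤ θ t)
    (hg : ∀ k l : ℕ, ∃ C : ℝ, 0 ≤ C ∧ ∀ t, SchwartzMap.seminorm ℂ k l (g t) ≤ C * θ t) :
    ∃ C : ℝ, 0 ≤ C ∧ ∀ t, fourierWeight A (g t) ≤ ENNReal.ofReal (C * θ t) := by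
  obtain ⟨C₁, q, hC₁, hq, hqb⟩ :=
    exists_lintegral_one_add_norm_pow_le (volume : Measure (Rn n)) A
  obtain ⟨C₂, hC₂, h⟩ := exists_continuous_seminorm_le hθ hg
    (q := q.comp (FourierTransform.fourierCLM ℂ 𝓢(Rn n, ℂ) : 𝓢(Rn n, ℂ) →ₗ[ℂ] 𝓢(Rn n, ℂ)))
    (hq.comp (FourierTransform.fourierCLM ℂ 𝓢(Rn n, ℂ)).continuous)
  refine ⟨C₁ * C₂, by positivity, fun t => (hqb _).trans (ENNReal.ofReal_le_ofReal ?_)⟩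
  rw [mul_assoc]
  gcongr
  exact h t

theorem exists_fourierWeight_dilate_le_of_le_one (A : ℕ) {ψ : 𝓢(Rn n, ℂ)} {R : ℕ}
    (hψ : MomentCondition R ψ) (η : 𝓢(Rn n, ℂ)) :
    ∃ C : ℝ, 0 ≤ C ∧ ∀ (t : ℝ) (ht : t ≠ 0), 0 < t → t ≤ 1 →
      fourierWeight A (schwartzMul (dilate t ht ψ) η) ≤ ENNReal.ofReal (C * t ^ R) := by
  obtain ⟨C, hC, h⟩ := exists_fourierWeight_le A
    (g := fun t : Set.Ioc (0 : ℝ) 1 => schwartzMul (dilate t t.2.1.ne' ψ) η)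
    (θ := fun t => (t : ℝ) ^ R) (fun t => pow_nonneg t.2.1.le R)
    (exists_seminorm_le_of_le_one hψ.iteratedFDeriv_eq_zero fun t x => schwartzMul_apply _ _ x)
  exact ⟨C, hC, fun t _ h₀ h₁ => h ⟨t, h₀, h₁⟩⟩

theorem exists_fourierWeight_dilate_le_of_one_le (A N : ℕ) (ψ : 𝓢(Rn n, ℂ)) {η : 𝓢(Rn n, ℂ)}
    {ρ : ℝ} (hρ : 0 < ρ) (hη : ∀ x ∈ tsupport η, ρ ≤ ‖x‖) :
    ∃ C : ℝ, 0 ≤ C ∧ ∀ (t : ℝ) (ht : t ≠ 0), 1 ≤ t →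
      fourierWeight A (schwartzMul (dilate t ht ψ) η) ≤ ENNReal.ofReal (C * (t ^ N)⁻¹) := by
  obtain ⟨C, hC, h⟩ := exists_fourierWeight_le A
    (g := fun t : Set.Ici (1 : ℝ) => schwartzMul (dilate t (one_pos.trans_le t.2).ne' ψ) η)
    (θ := fun t => ((t : ℝ) ^ N)⁻¹) (fun t => inv_nonneg.2 (pow_nonneg (one_pos.trans_le t.2).le N))
    (exists_seminorm_le_of_one_le ψ hρ hη N fun t x => schwartzMul_apply _ _ x)
  exact ⟨C, hC, fun t _ h₁ => h ⟨t, h₁⟩⟩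

/-! ### Calderón reproducing functions -/

theorem exists_schwartz_div {E : Type*} [NormedAddCommGroup E] [NormedSpace ℝ E]
    {χ : E → ℂ} (hχ : HasCompactSupport χ) (hχ' : ContDiff ℝ ∞ χ) (φ : 𝓢(E, ℂ))
    (h : ∀ x ∈ tsupport χ, φ x ≠ 0) :
    ∃ η : 𝓢(E, ℂ), tsupport η ⊆ tsupport χ ∧ ∀ x, η x * φ x = χ x := by
  have hsupp : Function.support (fun x => χ x / φ x) ⊆ Function.support χ := fun x hx h0 => by
    simp [h0] at hx
  have hsm : ContDiff ℝ ∞ fun x => χ x / φ x := by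
    refine contDiff_iff_contDiffAt.2 fun x => ?_
    by_cases hx : x ∈ tsupport χ
    · simp_rw [div_eq_mul_inv]
      exact hχ'.contDiffAt.mul ((φ.smooth ⊤).contDiffAt.inv (h x hx))
    · have h0 : (fun x => χ x / φ x) =ᶠ[nhds x] fun _ => 0 := by
        filter_upwards [(isClosed_tsupport χ).isOpen_compl.mem_nhds hx] with y hy
        rw [image_eq_zero_of_notMem_tsupport hy, zero_div]
      exact contDiffAt_const.congr_of_eventuallyEq h0
  refine ⟨(hχ.mono hsupp).toSchwartzMap hsm, closure_mono hsupp, fun x => ?_⟩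
  change χ x / φ x * φ x = χ x
  by_cases hx : φ x = 0
  · have : x ∉ tsupport χ := fun hx' => h x hx' hx
    rw [image_eq_zero_of_notMem_tsupport this]
    simp
  · exact div_mul_cancel₀ _ hx

/-- The Tauberian conditions yield a smooth resolution of unity subordinate to `φ₀, φ₁`. -/
theorem TauberianCondition.exists_resolution {ε k : ℝ} (hε : 0 < ε) (hk : 1 < k)
    {φ₀ φ₁ : 𝓢(Rn n, ℂ)} (h : TauberianCondition ε k φ₀ φ₁) :
    ∃ χ η₀ η₁ : 𝓢(Rn n, ℂ), χ 0 = 1 ∧ (∀ x, η₀ x * φ₀ x = χ x) ∧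
      (∀ x, η₁ x * φ₁ x = χ ((2 : ℝ)⁻¹ • x) - χ x) ∧ ∀ x ∈ tsupport η₁, ε ≤ ‖x‖ := by
  -- With these radii β is supported where φ₀ ≠ 0, and γ(x) = β(x/2) - β(x) in the annulus ε ≤ ‖x‖ ≤
  -- 2kε where φ₁ ≠ 0.
  let b : ContDiffBump (0 : Rn n) := ⟨ε, k * ε, hε, lt_mul_of_one_lt_left hε hk⟩
  let β : Rn n → ℂ := fun x => (b x : ℂ)
  have hβ : ContDiff ℝ ∞ β := Complex.ofRealCLM.contDiff.comp b.contDiff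
  have hβt : ∀ x, k * ε ≤ ‖x‖ → β x = 0 := fun x hx => by
    simp only [β, Complex.ofReal_eq_zero]
    exact b.zero_of_le_dist (by simpa using hx)
  have hβ1 : ∀ x, ‖x‖ ≤ ε → β x = 1 := fun x hx => by
    simp only [β, Complex.ofReal_eq_one]
    exact b.one_of_mem_closedBall (by simpa using hx)
  have hts : tsupport β ⊆ Metric.closedBall 0 (k * ε) := by
    refine closure_minimal (fun x hx => ?_) Metric.isClosed_closedBall
    rw [mem_closedBall_zero_iff]
    by_contra hc
    exact hx (hβt x (not_le.1 hc).le)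
  have hβc : HasCompactSupport β :=
    (isCompact_closedBall (0 : Rn n) (k * ε)).of_isClosed_subset (isClosed_tsupport _) hts
  let γ : Rn n → ℂ := fun x => β ((2 : ℝ)⁻¹ • x) - β x
  have hγ : ContDiff ℝ ∞ γ := (hβ.comp (contDiff_const_smul _)).sub hβ
  have htγ : tsupport γ ⊆ {x | ε ≤ ‖x‖ ∧ ‖x‖ ≤ 2 * k * ε} := by
    refine closure_minimal (fun x hx => ?_) ((isClosed_le continuous_const continuous_norm).inter
      (isClosed_le continuous_norm continuous_const))
    have hn : ‖(2 : ℝ)⁻¹ • x‖ = ‖x‖ / 2 := by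
      rw [norm_smul, norm_inv, Real.norm_ofNat]; ring
    constructor
    · by_contra hc
      rw [not_le] at hc
      refine hx ?_
      simp only [γ]
      rw [hβ1 x hc.le, hβ1 _ (by rw [hn]; linarith [norm_nonneg x]), sub_self]
    · by_contra hc
      rw [not_le] at hc
      refine hx ?_
      simp only [γ]
      have : k * ε ≤ ‖x‖ / 2 := by linarith
      rw [hβt x (by linarith [norm_nonneg x]), hβt _ (by rwa [hn]), sub_self]
  have hγc : HasCompactSupport γ :=
    (isCompact_closedBall (0 : Rn n) (2 * k * ε)).of_isClosed_subset (isClosed_tsupport _)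
      fun x hx => mem_closedBall_zero_iff.2 (htγ hx).2
  obtain ⟨η₀, -, hη₀⟩ := exists_schwartz_div hβc hβ φ₀ fun x hx =>
    norm_pos_iff.1 (h.1 x (mem_closedBall_zero_iff.1 (hts hx)))
  obtain ⟨η₁, hη₁t, hη₁⟩ := exists_schwartz_div hγc hγ φ₁ fun x hx =>
    norm_pos_iff.1 (h.2 x (htγ hx).1 (htγ hx).2)
  exact ⟨hβc.toSchwartzMap hβ, η₀, η₁, hβ1 0 (by simpa using hε.le), hη₀, hη₁,
    fun x hx => (htγ (hη₁t hx)).1⟩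

end Distributions

/-! ### Almost diagonal estimates between two dyadic systems. -/

section Dyadic

variable {n : ℕ}

/-- The dilation parameter of the `j`-th member of a dyadic system. -/
noncomputable def dyadicScale : ℕ → ℝ
  | 0 => 1
  | j + 1 => ((2 : ℝ) ^ j)⁻¹

/-- The generator of the `j`-th member of a dyadic system. -/
def dyadicGenerator (ψ₀ ψ₁ : 𝓢(Rn n, ℂ)) : ℕ → 𝓢(Rn n, ℂ)
  | 0 => ψ₀
  | _ + 1 => ψ₁

theorem dyadicScale_pos : ∀ j, 0 < dyadicScale j
  | 0 => one_pos
  | _ + 1 => by unfold dyadicScale; positivity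

theorem two_pow_mul_dyadicScale_le : ∀ j, (2 : ℝ) ^ j * dyadicScale j ≤ 2
  | 0 => by norm_num [dyadicScale]
  | j + 1 => by
    unfold dyadicScale
    rw [pow_succ, mul_right_comm, mul_inv_cancel₀ (by positivity), one_mul]

theorem dyadicSystem_eq_dilate (ψ₀ ψ₁ : 𝓢(Rn n, ℂ)) (j : ℕ) :
    dyadicSystem ψ₀ ψ₁ j =
      dilate (dyadicScale j) (dyadicScale_pos j).ne' (dyadicGenerator ψ₀ ψ₁ j) := by
  cases j with
  | zero =>
    ext x
    rw [dilate_apply]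
    simp [dyadicSystem, dyadicScale, dyadicGenerator]
  | succ j => rfl

theorem dyadicScale_div_ne_zero (ν j : ℕ) : dyadicScale ν / dyadicScale j ≠ 0 :=
  (div_pos (dyadicScale_pos ν) (dyadicScale_pos j)).ne'

/-- The symbols of the almost diagonal operators linking two dyadic systems, rescaled to unit
frequency. -/
noncomputable def linkSymbol (ψ₀ ψ₁ η₀ η₁ : 𝓢(Rn n, ℂ)) (ν j : ℕ) : 𝓢(Rn n, ℂ) :=
  schwartzMul (dilate (dyadicScale ν / dyadicScale j) (dyadicScale_div_ne_zero ν j)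
    (dyadicGenerator ψ₀ ψ₁ ν)) (dyadicGenerator η₀ η₁ j)

theorem dilate_linkSymbol_apply (ψ₀ ψ₁ η₀ η₁ φ₀ φ₁ : 𝓢(Rn n, ℂ)) (ν j : ℕ) (x : Rn n) :
    dilate (dyadicScale j) (dyadicScale_pos j).ne'
        (schwartzMul (linkSymbol ψ₀ ψ₁ η₀ η₁ ν j) (dyadicGenerator φ₀ φ₁ j)) x =
      dyadicGenerator η₀ η₁ j (dyadicScale j • x) * dyadicGenerator φ₀ φ₁ j (dyadicScale j • x) *
        dyadicSystem ψ₀ ψ₁ ν x := by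
  rw [dyadicSystem_eq_dilate, dilate_apply, dilate_apply, schwartzMul_apply, linkSymbol,
    schwartzMul_apply, dilate_apply, smul_smul, div_mul_cancel₀ _ (dyadicScale_pos j).ne']
  ring

theorem sum_dyadicGenerator_mul {χ φ₀ φ₁ η₀ η₁ : 𝓢(Rn n, ℂ)} (h₀ : ∀ x, η₀ x * φ₀ x = χ x)
    (h₁ : ∀ x, η₁ x * φ₁ x = χ ((2 : ℝ)⁻¹ • x) - χ x) (N : ℕ) (x : Rn n) :
    ∑ j ∈ Finset.range (N + 1), dyadicGenerator η₀ η₁ j (dyadicScale j • x) *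
      dyadicGenerator φ₀ φ₁ j (dyadicScale j • x) = χ (((2 : ℝ) ^ N)⁻¹ • x) := by
  induction N with
  | zero => simp [dyadicGenerator, dyadicScale, h₀]
  | succ N ih =>
    rw [Finset.sum_range_succ, ih]
    simp only [dyadicGenerator, dyadicScale, h₁, smul_smul]
    rw [pow_succ, mul_inv_rev]
    ring

/-- The partial sums of the symbols telescope to χ(2^(-N)x) ψ_ν(x), which tends to ψ_ν in the
Schwartz space, and h ↦ (ĥ * f)(y) is continuous there. -/
theorem enorm_conv_dyadicSystem_le_tsum {χ φ₀ φ₁ η₀ η₁ : 𝓢(Rn n, ℂ)} (hχ : χ 0 = 1)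
    (h₀ : ∀ x, η₀ x * φ₀ x = χ x) (h₁ : ∀ x, η₁ x * φ₁ x = χ ((2 : ℝ)⁻¹ • x) - χ x)
    (ψ₀ ψ₁ : 𝓢(Rn n, ℂ)) (f : 𝓢'(Rn n, ℂ)) (ν : ℕ) (y : Rn n) :
    ‖conv (fourierHat (dyadicSystem ψ₀ ψ₁ ν)) f y‖ₑ ≤
      ∑' j, ‖convCLM f y (dilate (dyadicScale j) (dyadicScale_pos j).ne'
        (schwartzMul (linkSymbol ψ₀ ψ₁ η₀ η₁ ν j) (dyadicGenerator φ₀ φ₁ j)))‖ₑ := by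
  set d : ℕ → 𝓢(Rn n, ℂ) := fun j => dilate (dyadicScale j) (dyadicScale_pos j).ne'
        (schwartzMul (linkSymbol ψ₀ ψ₁ η₀ η₁ ν j) (dyadicGenerator φ₀ φ₁ j))
  have hlim : Filter.Tendsto (fun N => ∑ j ∈ Finset.range (N + 1), d j) Filter.atTop
      (nhds (dyadicSystem ψ₀ ψ₁ ν)) := by
    refine tendsto_of_cutoff hχ (t := fun N => ((2 : ℝ) ^ N)⁻¹)
      (fun N => ⟨by positivity, inv_le_one_of_one_le₀ (one_le_pow₀ one_le_two)⟩) ?_ fun N x => ?_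
    · simp_rw [← inv_pow]
      exact tendsto_pow_atTop_nhds_zero_of_lt_one (by norm_num) (by norm_num)
    · rw [sum_apply]
      simp only [d, dilate_linkSymbol_apply]
      rw [← Finset.sum_mul, sum_dyadicGenerator_mul h₀ h₁]
  have hlim' := (((convCLM f y).continuous.tendsto _).comp hlim).enorm
  refine le_of_tendsto' hlim' fun N => ?_
  simp only [Function.comp_apply, map_sum]
  exact (enorm_sum_le _ _).trans (ENNReal.sum_le_tsum _)

theorem enorm_conv_le_peetre_mul {a : ℝ} (ψ : ℕ → 𝓢(Rn n, ℂ)) (f : 𝓢'(Rn n, ℂ)) (j : ℕ)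
    (x y : Rn n) :
    ‖conv (fourierHat (ψ j)) f y‖ₑ ≤
      peetre ψ a f j x * ENNReal.ofReal (1 + ‖(2 : ℝ) ^ j • (y - x)‖ ^ a) := by
  have hpos : 0 < 1 + ‖(2 : ℝ) ^ j • (y - x)‖ ^ a := by positivity
  calc ‖conv (fourierHat (ψ j)) f y‖ₑ
      = ENNReal.ofReal (‖conv (fourierHat (ψ j)) f y‖ / (1 + ‖(2 : ℝ) ^ j • (y - x)‖ ^ a)) *
          ENNReal.ofReal (1 + ‖(2 : ℝ) ^ j • (y - x)‖ ^ a) := by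
        rw [← ENNReal.ofReal_mul (by positivity), div_mul_cancel₀ _ hpos.ne', ofReal_norm]
    _ ≤ _ := by
        gcongr
        exact le_iSup (fun y => ENNReal.ofReal
          (‖conv (fourierHat (ψ j)) f y‖ / (1 + ‖(2 : ℝ) ^ j • (y - x)‖ ^ a))) y

/-- Geometric off-diagonal factors with separate rates below and above the diagonal. -/
noncomputable def offDiag (b c : ℝ) (ν j : ℕ) : ℝ :=
  if j ≤ ν then b ^ (ν - j) else c ^ (j - ν)

theorem offDiag_nonneg {b c : ℝ} (hb : 0 ≤ b) (hc : 0 ≤ c) (ν j : ℕ) : 0 ≤ offDiag b c ν j := by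
  unfold offDiag; split_ifs <;> positivity

theorem offDiag_mul (b c b' c' : ℝ) (ν j : ℕ) :
    offDiag b c ν j * offDiag b' c' ν j = offDiag (b * b') (c * c') ν j := by
  unfold offDiag; split_ifs <;> rw [mul_pow]

theorem offDiag_le {b c s : ℝ} (hb : 0 ≤ b) (hc : 0 ≤ c) (hbs : b ≤ s) (hcs : c ≤ s) (ν j : ℕ) :
    offDiag b c ν j ≤ s ^ Nat.dist ν j := by
  unfold offDiag
  split_ifs with h
  · rw [Nat.dist_eq_sub_of_le_right h]; gcongr
  · rw [Nat.dist_eq_sub_of_le (not_le.1 h).le]; gcongr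

/-- A ratio t of scales at most 1 calls for the moment condition, a ratio at least 1 for the support
of η₁ away from 0. The generators of index 0 are separate cases, and for ν = j = 0 no decay is
needed. -/
theorem exists_fourierWeight_linkSymbol_le (A N : ℕ) (ψ₀ : 𝓢(Rn n, ℂ)) {ψ₁ : 𝓢(Rn n, ℂ)} {R : ℕ}
    (hψ : MomentCondition R ψ₁) (η₀ : 𝓢(Rn n, ℂ)) {η₁ : 𝓢(Rn n, ℂ)} {ρ : ℝ} (hρ : 0 < ρ)
    (hη : ∀ x ∈ tsupport η₁, ρ ≤ ‖x‖) :
    ∃ C : ℝ, 0 < C ∧ ∀ ν j, fourierWeight A (linkSymbol ψ₀ ψ₁ η₀ η₁ ν j) ≤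
      ENNReal.ofReal (C * offDiag (2 ^ R)⁻¹ (2 ^ N)⁻¹ ν j) := by
  obtain ⟨C₁, hC₁, h₁⟩ := exists_fourierWeight_dilate_le_of_le_one A (R := 0) (ψ := ψ₀)
    (fun m hm => absurd hm (Nat.not_lt_zero m)) η₀
  obtain ⟨C₂, hC₂, h₂⟩ := exists_fourierWeight_dilate_le_of_le_one A hψ η₀
  obtain ⟨C₃, hC₃, h₃⟩ := exists_fourierWeight_dilate_le_of_le_one A hψ η₁
  obtain ⟨C₄, hC₄, h₄⟩ := exists_fourierWeight_dilate_le_of_one_le A N ψ₀ hρ hη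
  obtain ⟨C₅, hC₅, h₅⟩ := exists_fourierWeight_dilate_le_of_one_le A N ψ₁ hρ hη
  -- The scales of indices 0 and 1 are both 1, so pairing index 0 with a positive index loses one
  -- power of 2^(-R) or 2^(-N); the factors 2^R and 2^N restore it.
  refine ⟨C₁ + 2 ^ R * C₂ + C₃ + 2 ^ N * C₄ + C₅ + 1, by positivity, fun ν j => ?_⟩
  have hR : 0 ≤ 2 ^ R * C₂ := by positivity
  have hN : 0 ≤ 2 ^ N * C₄ := by positivity
  unfold linkSymbol offDiag
  rcases ν with _ | ν <;> rcases j with _ | j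
  · refine (h₁ _ (dyadicScale_div_ne_zero 0 0) (by simp [dyadicScale])
      (by simp [dyadicScale])).trans (ENNReal.ofReal_le_ofReal ?_)
    simp
    linarith
  · refine (h₄ _ (dyadicScale_div_ne_zero 0 (j + 1)) ?_).trans (ENNReal.ofReal_le_ofReal ?_)
    · simpa [dyadicScale] using one_le_pow₀ (M₀ := ℝ) one_le_two
    · rw [if_neg (by omega)]
      simp only [dyadicScale, one_div, inv_inv, Nat.sub_zero]
      calc C₄ * (((2 : ℝ) ^ j) ^ N)⁻¹ = 2 ^ N * C₄ * ((2 ^ N)⁻¹) ^ (j + 1) := by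
            rw [pow_succ, ← pow_mul, mul_comm j N, pow_mul, inv_pow]
            field_simp
        _ ≤ _ := by gcongr; linarith
  · refine (h₂ _ (dyadicScale_div_ne_zero (ν + 1) 0) (by simp [dyadicScale]) ?_).trans
      (ENNReal.ofReal_le_ofReal ?_)
    · simpa [dyadicScale] using inv_le_one_of_one_le₀ (one_le_pow₀ (M₀ := ℝ) one_le_two)
    · rw [if_pos (by omega)]
      simp only [dyadicScale, div_one, Nat.sub_zero]
      calc C₂ * (((2 : ℝ) ^ ν)⁻¹) ^ R = 2 ^ R * C₂ * ((2 ^ R)⁻¹) ^ (ν + 1) := by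
            rw [pow_succ, inv_pow, ← pow_mul, mul_comm ν R, pow_mul, inv_pow]
            field_simp
        _ ≤ _ := by gcongr; linarith
  · by_cases hj : j ≤ ν
    · have ht : dyadicScale (ν + 1) / dyadicScale (j + 1) = ((2 : ℝ) ^ (ν - j))⁻¹ := by
        simp only [dyadicScale]
        rw [pow_sub₀ _ two_ne_zero hj]
        field_simp
      refine (h₃ _ (dyadicScale_div_ne_zero (ν + 1) (j + 1))
        (div_pos (dyadicScale_pos _) (dyadicScale_pos _)) ?_).trans (ENNReal.ofReal_le_ofReal ?_)
      · rw [ht]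
        exact inv_le_one_of_one_le₀ (one_le_pow₀ one_le_two)
      · rw [if_pos (by omega), ht, show ν + 1 - (j + 1) = ν - j by omega, inv_pow, inv_pow,
          ← pow_mul, ← pow_mul, mul_comm R]
        gcongr
        linarith
    · have ht : dyadicScale (ν + 1) / dyadicScale (j + 1) = (2 : ℝ) ^ (j - ν) := by
        simp only [dyadicScale]
        rw [pow_sub₀ _ two_ne_zero (by omega)]
        field_simp
      refine (h₅ _ (dyadicScale_div_ne_zero (ν + 1) (j + 1)) ?_).trans
        (ENNReal.ofReal_le_ofReal ?_)
      · rw [ht]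
        exact one_le_pow₀ one_le_two
      · rw [if_neg (by omega), ht, show j + 1 - (ν + 1) = j - ν by omega, inv_pow,
          ← pow_mul, ← pow_mul, mul_comm N]
        gcongr
        linarith

theorem one_add_norm_two_pow_smul_rpow_le {a : ℝ} (ha : 0 ≤ a) (ν j : ℕ) (z : Rn n) :
    1 + ‖(2 : ℝ) ^ j • z‖ ^ a ≤ offDiag 1 (2 ^ a) ν j * (1 + ‖(2 : ℝ) ^ ν • z‖ ^ a) := by
  have hn : ∀ i : ℕ, ‖(2 : ℝ) ^ i • z‖ = 2 ^ i * ‖z‖ := fun i => by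
    rw [norm_smul, norm_pow, Real.norm_ofNat]
  rw [hn, hn]
  unfold offDiag
  split_ifs with h
  · rw [one_pow, one_mul]
    gcongr
    exact one_le_two
  · have h2 : (2 : ℝ) ^ j * ‖z‖ = 2 ^ (j - ν) * (2 ^ ν * ‖z‖) := by
      rw [← mul_assoc, ← pow_add, Nat.sub_add_cancel (by omega)]
    have h3 : ((2 : ℝ) ^ (j - ν)) ^ a = (2 ^ a) ^ (j - ν) := by
      rw [← Real.rpow_natCast, ← Real.rpow_natCast, ← Real.rpow_mul two_pos.le,
        ← Real.rpow_mul two_pos.le, mul_comm]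
    rw [h2, Real.mul_rpow (by positivity) (by positivity), h3, mul_add, mul_one]
    gcongr
    exact one_le_pow₀ (Real.one_le_rpow one_le_two ha)

theorem IsAdmissibleWeight.le_offDiag_mul {α α₁ α₂ : ℝ} {w : ℕ → Rn n → ℝ}
    (hw : IsAdmissibleWeight α α₁ α₂ w) (ν j : ℕ) (x : Rn n) :
    w ν x ≤ offDiag (2 ^ α₂) (2 ^ (-α₁)) ν j * w j x := by
  unfold offDiag
  split_ifs with h
  · obtain ⟨m, rfl⟩ := Nat.exists_eq_add_of_le h
    rw [Nat.add_sub_cancel_left]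
    clear h
    induction m with
    | zero => simp
    | succ m ih =>
      refine (hw.upper (j + m) x).trans ?_
      rw [pow_succ', mul_assoc]
      gcongr
  · obtain ⟨m, rfl⟩ := Nat.exists_eq_add_of_le (not_le.1 h).le
    rw [Nat.add_sub_cancel_left]
    clear h
    induction m with
    | zero => simp
    | succ m ih =>
      refine ih.trans ?_
      rw [pow_succ, mul_assoc]
      gcongr
      rw [Real.rpow_neg two_pos.le, ← div_eq_inv_mul, le_div_iff₀' (by positivity)]
      exact hw.lower (ν + m) x

/-- Pointwise domination of the weighted Peetre maximal functions by a discrete convolution. -/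
theorem exists_weightedPeetre_le_tsum {α α₁ α₂ : ℝ} {w : ℕ → Rn n → ℝ}
    (hw : IsAdmissibleWeight α α₁ α₂ w) {a : ℝ} (ha : 0 ≤ a) {R : ℕ} (ψ₀ : 𝓢(Rn n, ℂ))
    {ψ₁ φ₀ φ₁ : 𝓢(Rn n, ℂ)} (hψ : MomentCondition R ψ₁) {ε k : ℝ} (hε : 0 < ε) (hk : 1 < k)
    (hφ : TauberianCondition ε k φ₀ φ₁) :
    ∃ C : ℝ, 0 < C ∧ ∀ (f : 𝓢'(Rn n, ℂ)) (ν : ℕ) (x : Rn n),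
      weightedPeetre (dyadicSystem ψ₀ ψ₁) a w f ν x ≤
        ENNReal.ofReal C * ∑' j, ENNReal.ofReal (2 ^ (α₂ - R)) ^ Nat.dist ν j *
          weightedPeetre (dyadicSystem φ₀ φ₁) a w f j x := by
  obtain ⟨χ, η₀, η₁, hχ, h₀, h₁, hη⟩ := hφ.exists_resolution hε hk
  obtain ⟨A, hA⟩ := exists_nat_ge a
  -- Chosen so that 2^(-N) · 2^a · 2^(-α₁) ≤ 2^(α₂-R): the decay above the diagonal then matches
  -- that below.
  obtain ⟨N, hN⟩ := exists_nat_ge (a - α₁ + R - α₂)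
  obtain ⟨K, hK, hKw⟩ := exists_fourierWeight_linkSymbol_le A N ψ₀ hψ η₀ hε hη
  refine ⟨2 * 16 ^ A * K, by positivity, fun f ν x => ?_⟩
  set B : ℕ → ℝ := fun j => offDiag (2 ^ R)⁻¹ (2 ^ N)⁻¹ ν j
  have hB : ∀ j, 0 ≤ B j := offDiag_nonneg (by positivity) (by positivity) ν
  set D : ℕ → ℝ := fun j => offDiag 1 (2 ^ a) ν j
  have hD : ∀ j, 0 ≤ D j := offDiag_nonneg (by positivity) (by positivity) ν
  set P : ℕ → ℝ≥0∞ := fun j => peetre (dyadicSystem φ₀ φ₁) a f j x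
  have hpt : ∀ y, ‖conv (fourierHat (dyadicSystem ψ₀ ψ₁ ν)) f y‖ₑ ≤
      (∑' j, ENNReal.ofReal (2 * 16 ^ A) * ENNReal.ofReal (K * B j) * P j * ENNReal.ofReal (D j)) *
        ENNReal.ofReal (1 + ‖(2 : ℝ) ^ ν • (y - x)‖ ^ a) := by
    intro y
    refine (enorm_conv_dyadicSystem_le_tsum hχ h₀ h₁ ψ₀ ψ₁ f ν y).trans ?_
    rw [← ENNReal.tsum_mul_right]
    refine ENNReal.tsum_le_tsum fun j => ?_
    refine (enorm_convCLM_dilate_schwartzMul_le f x y (dyadicScale_pos j) (by positivity)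
      (two_pow_mul_dyadicScale_le j) ha hA _ _ (P := P j) fun y' => ?_).trans ?_
    · rw [← dyadicSystem_eq_dilate, convCLM_apply]
      exact enorm_conv_le_peetre_mul (dyadicSystem φ₀ φ₁) f j x y'
    · rw [mul_assoc _ (ENNReal.ofReal (D j)), ← ENNReal.ofReal_mul (hD j)]
      gcongr
      · exact hKw ν j
      · exact one_add_norm_two_pow_smul_rpow_le ha ν j (y - x)
  have hpeetre : peetre (dyadicSystem ψ₀ ψ₁) a f ν x ≤
      ∑' j, ENNReal.ofReal (2 * 16 ^ A) * ENNReal.ofReal (K * B j) * P j *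
        ENNReal.ofReal (D j) := by
    refine iSup_le fun y => ?_
    have hpos : 0 < 1 + ‖(2 : ℝ) ^ ν • (y - x)‖ ^ a := by positivity
    rw [ENNReal.ofReal_div_of_pos hpos, ofReal_norm]
    exact ENNReal.div_le_of_le_mul (hpt y)
  unfold weightedPeetre
  grw [hpeetre]
  rw [← ENNReal.tsum_mul_right, ← ENNReal.tsum_mul_left]
  refine ENNReal.tsum_le_tsum fun j => ?_
  have hBDW : K * B j * D j * offDiag (2 ^ α₂) (2 ^ (-α₁)) ν j ≤
      K * (2 ^ (α₂ - R)) ^ Nat.dist ν j := by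
    rw [mul_assoc K, mul_assoc K, offDiag_mul, offDiag_mul]
    gcongr
    refine offDiag_le (by positivity) (by positivity) ?_ ?_ ν j
    · rw [mul_one, Real.rpow_sub two_pos, Real.rpow_natCast, div_eq_inv_mul]
    · rw [← Real.rpow_natCast, ← Real.rpow_neg two_pos.le, ← Real.rpow_add two_pos,
        ← Real.rpow_add two_pos]
      exact Real.rpow_le_rpow_of_exponent_le one_le_two (by linarith)
  have hreal : 2 * 16 ^ A * (K * B j) * D j * w ν x ≤
      2 * 16 ^ A * K * (2 ^ (α₂ - R)) ^ Nat.dist ν j * w j x := by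
    calc 2 * 16 ^ A * (K * B j) * D j * w ν x
        ≤ 2 * 16 ^ A * (K * B j) * D j * (offDiag (2 ^ α₂) (2 ^ (-α₁)) ν j * w j x) := by
          have := hB j
          have := hD j
          gcongr
          exact hw.le_offDiag_mul ν j x
      _ = 2 * 16 ^ A * (K * B j * D j * offDiag (2 ^ α₂) (2 ^ (-α₁)) ν j) * w j x := by ring
      _ ≤ 2 * 16 ^ A * (K * (2 ^ (α₂ - R)) ^ Nat.dist ν j) * w j x := by
          have := (hw.pos j x).le
          gcongr
      _ = _ := by ring
  have hK' := hB j
  have hD' := hD j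
  calc ENNReal.ofReal (2 * 16 ^ A) * ENNReal.ofReal (K * B j) * P j * ENNReal.ofReal (D j) *
        ENNReal.ofReal (w ν x)
      = ENNReal.ofReal (2 * 16 ^ A * (K * B j) * D j * w ν x) * P j := by
        rw [ENNReal.ofReal_mul (p := 2 * 16 ^ A * (K * B j) * D j) (by positivity),
          ENNReal.ofReal_mul (p := 2 * 16 ^ A * (K * B j)) (by positivity),
          ENNReal.ofReal_mul (p := 2 * 16 ^ A) (by positivity)]
        ring
    _ ≤ ENNReal.ofReal (2 * 16 ^ A * K * (2 ^ (α₂ - R)) ^ Nat.dist ν j * w j x) * P j := by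
        gcongr
    _ = _ := by
        rw [ENNReal.ofReal_mul (by positivity), ENNReal.ofReal_mul (by positivity),
          ENNReal.ofReal_pow (by positivity)]
        ring

end Dyadic

end VarMorrey

theorem theorem4p7 {n : ℕ} (hn : 0 < n)
    {α α₁ α₂ : ℝ} {w : ℕ → VarMorrey.Rn n → ℝ} (hw : VarMorrey.IsAdmissibleWeight α α₁ α₂ w)
    {p q u : VarMorrey.Rn n → ℝ≥0∞}
    (hp : VarMorrey.IsVarExponent p) (hq : VarMorrey.IsVarExponent q)
    (hu : VarMorrey.IsVarExponent u) (hpu : ∀ x, p x ≤ u x)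
    {a : ℝ} (ha : 0 < a) {R : ℕ} (hR : α₂ < (R : ℝ))
    (ψ₀ ψ₁ φ₀ φ₁ : 𝓢(VarMorrey.Rn n, ℂ))
    (hψ : VarMorrey.MomentCondition R ψ₁)
    {ε k : ℝ} (hε : 0 < ε) (hk : k ∈ Set.Ioc (1 : ℝ) 2)
    (hφ : VarMorrey.TauberianCondition ε k φ₀ φ₁) :
    ∃ c : ℝ, 0 < c ∧ ∀ f : 𝓢'(VarMorrey.Rn n, ℂ),
      VarMorrey.morreyEllNorm p u q
          (VarMorrey.weightedPeetre (VarMorrey.dyadicSystem ψ₀ ψ₁) a w f) ≤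
        ENNReal.ofReal c *
          VarMorrey.morreyEllNorm p u q
            (VarMorrey.weightedPeetre (VarMorrey.dyadicSystem φ₀ φ₁) a w f) := by
  obtain ⟨C, hC, h⟩ := VarMorrey.exists_weightedPeetre_le_tsum hw ha.le ψ₀ hψ hε hk.1 hφ
  -- Half the exponent, because the convolution inequality is stated for the rate s * s.
  have hs : ENNReal.ofReal (2 ^ ((α₂ - R) / 2)) < 1 := by
    rw [ENNReal.ofReal_lt_one]
    exact Real.rpow_lt_one_of_one_lt_of_neg one_lt_two (by linarith)
  obtain ⟨c, hc, hcG⟩ := VarMorrey.exists_morreyEllNorm_le p u hq hs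
    (A := ENNReal.ofReal C) (ENNReal.ofReal_pos.2 hC).ne' ENNReal.ofReal_ne_top
  refine ⟨c, hc, fun f => hcG _ _ fun ν x => ?_⟩
  rw [← ENNReal.ofReal_mul (by positivity), ← Real.rpow_add two_pos, add_halves]
  exact h f ν x
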